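/- Let $k$ be an ordered field. An ordered vector space over $k$ is a (totally) ordered abelian group $\Gamma$ with a $k$-vector space structure such that $c\gamma>0$ for all $c>0$ in $k$ and $\gamma>0$ in $\Gamma$. Write $\Gamma^{\neq}=\Gamma\setminus\{0\}$, $\Gamma^{>}=\{\gamma\in\Gamma:\gamma>0\}$. An $H$-couple over $k$ is a pair $(\Gamma,\psi)$ where $\Gamma$ is an ordered vector space over $k$ and $\psi:\Gamma^{\neq}\to\Gamma$ is a map such that for all $\alpha,\beta\in\Gamma^{\neq}$: (AC1) if $\alpha+\beta\neq 0$, then $\psi(\alpha+\beta)\ge\min(\psi(\alpha),\psi(\beta))$; (AC2) $\psi(m\alpha)=\psi(\alpha)$ for all nonzero $m\in\mathbb Z$; (AC3) if $\alpha>0$, then $\alpha+\psi(\alpha)>\psi(\beta)$; (HC) if $0<\alpha\le\beta$, then $\psi(\alpha)\ge\psi(\beta)$; and moreover $\psi(c\alpha)=\psi(\alpha)$ for all nonzero $c\in k$. Put $\Psi:=\psi(\Gamma^{\neq})$ and, for $\alpha\in\Gamma^{\ne}$, $\alpha':=\alpha+\psi(\alpha)$. The $H$-couple is closed if $\Gamma$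 is divisible, $\Psi$ is downward closed in $\Gamma$, and $\Gamma=\{\alpha':\alpha\in\Gamma^{\neq}\}$. An $H$-cut in $(\Gamma,\psi)$ is a downward closed set $P\subseteq\Gamma$ such that $\Psi\subseteq P$ and $p<\alpha'$ for all $p\in P$ and $\alpha\in\Gamma^{>}$. An $H$-triple over $k$ is a triple $(\Gamma,\psi,P)$ with $(\Gamma,\psi)$ an $H$-couple over $k$ and $P$ an $H$-cut in it; it is closed if $(\Gamma,\psi)$ is closed (and then $P=\Psi$). Let $\mathcal L_k$ be the one-sorted first-order language with constant symbols $0,\infty$, unary function symbols $-$ and $\psi$, a unary function symbol for each scalar $c\in k$, a binary function symbol $+$, a binary relation symbol $<$, and a unary relation symbol $P$. View an $H$-triple $(\Gamma,\psi,P)$ over $k$ as an $\mathcal L_k$-structure with underlying set $\Gamma_\infty=\Gamma\cup\{\infty\}$, where $\infty\notin\Gamma$: the symbols have their usual meaning on $\Gamma$, $\gamma<\infty$ for all $\gamma\in\Gamma$, $P$ is interpreted as the set $P\subseteq\Gamma$, and $$\psi(0)=\psi(\infty)=\gamma+\infty=\infty+\gamma=\infty+\infty=-\infty=c\infty=\infty\qquad(\gamma\in\Gamma,\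 c\in k).$$ **Theorem.** The $\mathcal L_k$-theory of closed $H$-triples over $k$ (the set of all $\mathcal L_k$-sentences true in every closed $H$-triple over $k$) has quantifier elimination: for every $n\ge 0$, every $\mathcal L_k$-formula $\varphi(x_1,\dots,x_n)$ is equivalent, modulo this theory, to a quantifier-free $\mathcal L_k$-formula $\theta(x_1,\dots,x_n)$. -/

import Mathlib

universe u w

/-! ### Quantifier elimination -/

/-- A theory `T` has quantifier elimination: every formula `φ(x₁, …, xₙ)` is equivalent modulo `T`
to a quantifier-free formula `θ(x₁, …, xₙ)` in the same variables (`n = 0` is allowed). -/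
def FirstOrder.Language.Theory.HasQE {L : FirstOrder.Language} (T : L.Theory) : Prop :=
  ∀ (n : ℕ) (φ : L.Formula (Fin n)),
    ∃ θ : L.Formula (Fin n), FirstOrder.Language.BoundedFormula.IsQF θ ∧ T.Iff φ θ

namespace HTriple

/-! ### H-couples, H-cuts and closed H-triples

Throughout, a map `ψ : Γ^{≠} → Γ` is represented by a total function `ψ : Γ → Γ` whose value at `0`
is never used: all conditions below only involve `ψ γ` with `γ ≠ 0`. -/

section Couples

variable {Γ : Type*} [AddCommGroup Γ] [LinearOrder Γ]

/-- `(Γ, ψ)` is an `H`-couple (an asymptotic couple of `H`-type), `Γ` an ordered abelian group. -/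
structure IsHCouple (ψ : Γ → Γ) : Prop where
  ac1 : ∀ α β : Γ, α ≠ 0 → β ≠ 0 → α + β ≠ 0 → min (ψ α) (ψ β) ≤ ψ (α + β)
  ac2 : ∀ (m : ℤ) (α : Γ), m ≠ 0 → α ≠ 0 → ψ (m • α) = ψ α
  ac3 : ∀ α β : Γ, β ≠ 0 → 0 < α → ψ β < α + ψ α
  hc : ∀ α β : Γ, 0 < α → α ≤ β → ψ β ≤ ψ α

/-- `(Γ, ψ)` is an `H`-couple over the ordered field `k`, `Γ` an ordered vector space over `k`. -/
structure IsHCoupleOver (k : Type*) [Field k] [Module k Γ] (ψ : Γ → Γ) : Prop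
    extends IsHCouple ψ where
  psi_smul : ∀ (c : k) (γ : Γ), c ≠ 0 → γ ≠ 0 → ψ (c • γ) = ψ γ

/-- The set `Ψ = ψ(Γ^{≠})`. -/
def PsiSet (ψ : Γ → Γ) : Set Γ := ψ '' {γ | γ ≠ 0}

/-- Asymptotic integration: `Γ = (Γ^{≠})'`, where `α' = α + ψ(α)`. -/
def HasAsymptoticIntegration (ψ : Γ → Γ) : Prop :=
  ∀ γ : Γ, ∃ α : Γ, α ≠ 0 ∧ α + ψ α = γ

/-- Closedness of an `H`-couple: `Γ` is divisible, `Ψ` is downward closed in `Γ`, and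
`(Γ, ψ)` has asymptotic integration. -/
structure IsClosedCouple (ψ : Γ → Γ) : Prop where
  divisible : ∀ n : ℕ, n ≠ 0 → ∀ γ : Γ, ∃ δ : Γ, n • δ = γ
  isLowerSet_psiSet : IsLowerSet (PsiSet ψ)
  asymptoticIntegration : HasAsymptoticIntegration ψ

/-- `P` is an `H`-cut in `(Γ, ψ)`: it is downward closed and `Ψ ⊆ P < (Γ^{>})'`. -/
structure IsHCut (ψ : Γ → Γ) (P : Set Γ) : Prop where
  isLowerSet : IsLowerSet P
  psiSet_subset : PsiSet ψ ⊆ P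
  lt_deriv : ∀ p ∈ P, ∀ α : Γ, 0 < α → p < α + ψ α

/-- `(Γ, ψ, P)` is an `H`-triple over `k`. -/
structure IsHTriple (k : Type*) [Field k] [Module k Γ] (ψ : Γ → Γ) (P : Set Γ) : Prop where
  couple : IsHCoupleOver k ψ
  cut : IsHCut ψ P

/-- `(Γ, ψ, P)` is a closed `H`-triple over `k`. -/
structure IsClosedHTriple (k : Type*) [Field k] [Module k Γ] (ψ : Γ → Γ) (P : Set Γ) : Prop
    extends IsHTriple k ψ P where
  closed : IsClosedCouple ψ

end Couples

/-! ### The language and the theory -/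

/-- Function symbols: `0`, `∞`, `-`, `ψ`, a unary symbol for each scalar `c : k`, and `+`. -/
inductive Func (k : Type*) : ℕ → Type _
  | zero : Func k 0
  | infty : Func k 0
  | neg : Func k 1
  | psi : Func k 1
  | smul (c : k) : Func k 1
  | add : Func k 2

/-- Relation symbols: the unary predicate `P` and the order `<`. -/
inductive Rel : ℕ → Type
  | cut : Rel 1
  | lt : Rel 2

/-- The language `L_k`: ordered vector spaces over `k`, augmented by `∞`, `ψ` and `P`. -/
def lang (k : Type*) : FirstOrder.Language := ⟨Func k, Rel⟩

section Interpretation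

variable {Γ : Type*} [AddCommGroup Γ] [LinearOrder Γ]

/-- The extension of `ψ` to `Γ_∞` with `ψ(0) = ψ(∞) = ∞`. -/
def psiTop (ψ : Γ → Γ) : WithTop Γ → WithTop Γ
  | ⊤ => ⊤
  | (γ : Γ) => if γ = 0 then ⊤ else (ψ γ : WithTop Γ)

/-- `(Γ, ψ, P)` as an `L_k`-structure with underlying set `Γ_∞ = Γ ∪ {∞}`; here `γ < ∞` for
`γ ∈ Γ`, `∞ ∉ P`, and `∞` is absorbing for `-`, `+`, and all scalar multiplications. -/
@[reducible]
def toStructure (k : Type*) [Field k] [Module k Γ] (ψ : Γ → Γ) (P : Set Γ) :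
    (lang k).Structure (WithTop Γ) where
  funMap {_} f := match f with
    | Func.zero => fun _ => ((0 : Γ) : WithTop Γ)
    | Func.infty => fun _ => ⊤
    | Func.neg => fun x => WithTop.map (fun γ : Γ => -γ) (x 0)
    | Func.psi => fun x => psiTop ψ (x 0)
    | Func.smul c => fun x => WithTop.map (fun γ : Γ => c • γ) (x 0)
    | Func.add => fun x => x 0 + x 1
  RelMap {_} r := match r with
    | Rel.cut => fun x => ∃ γ ∈ P, x 0 = (γ : WithTop Γ)
    | Rel.lt => fun x => x 0 < x 1

end Interpretation

/-- The `L_k`-theory of closed `H`-triples over the ordered field `k`: the set of all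
`L_k`-sentences that are true in every closed `H`-triple `(Γ, ψ, P)` over `k`.
(`PosSMulStrictMono k Γ` says that multiplication by positive scalars is strictly increasing.) -/
def closedTheory (k : Type u) [Field k] [LinearOrder k] : (lang k).Theory :=
  {σ | ∀ (Γ : Type (max u w)) [AddCommGroup Γ] [LinearOrder Γ] [IsOrderedAddMonoid Γ]
      [Module k Γ] [PosSMulStrictMono k Γ] (ψ : Γ → Γ) (P : Set Γ),
      IsClosedHTriple k ψ P →
        @FirstOrder.Language.Sentence.Realize (lang k) (WithTop Γ) (toStructure k ψ P) σ}

end HTriple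

set_option linter.unusedSectionVars false

namespace HTriple

/-! ### Elementary properties of H-couples -/

section Basic

variable {Γ : Type*} [AddCommGroup Γ] [LinearOrder Γ] [IsOrderedAddMonoid Γ] {ψ : Γ → Γ}

namespace IsHCouple

/-! The proof is an embedding test. Given tuples of the same quantifier-free type in closed
H-triples `M` (countable) and `N` (countably saturated), the isomorphism between the substructures
they generate must extend to an embedding of `M` into `N`. Partial isomorphisms are handled as
graphs `G ⊆ M × N`; Zorn's lemma gives a maximal one, and the core of the proof is that its domain
`A` is all of `M` (`IsMaximalIsoGraph.map_fst_eq_top`).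

The tools are that `ψ` is a convex valuation (with `ψ 0 = ∞`) and that it is contracting
(`psi_lt_psi_sub`). Each way in which `A` could fall short permits an extension, against maximality.
So `A` has asymptotic integration, the sign of a new integral being dictated by `P`
(`exists_add_psi_eq`). Hence `ψ` has no largest value on `A`, and every element of `A ∩ P` is a
value of `ψ` on `A` (`exists_psi_eq`). No element of `M` lies in the gap between the values `ψ e`
and the derivatives `|e| + ψ e`, `e ∈ A` nonzero (`exists_bound`); from then on preservation of `P`
is automatic.

Suppose now `x₀ ∉ A`. If all values `ψ(x₀ - a)`, `a ∈ A`, were in `A`, then `x₀` could be imitated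
in `N` without creating new values; so some `ψ(x₀ - a₀)` is again outside `A`
(`exists_psi_sub_notMem`). Iterating yields an infinite chain `y₀, y₁ = ψ(y₀) - a₁, ...` whose
values are all new and, by contraction, strictly increasing. Finite parts of it are imitated inside
`A` (`exists_chain_approx`), so saturation provides a parallel chain in `N`. Adjoining both chains
in full gives a larger partial isomorphism, a contradiction.

Saturated closed H-triples come from ultraproducts over `ℕ`, which also play the role of compactness
(`exists_isQF_iff_exists`). Passing to a countable `M` needs countably many scalars; a single
formula involves only countably many, so the general case descends to a countable subfield of `k`.
-/

theorem psi_neg (h : IsHCouple ψ) {a : Γ} (ha : a ≠ 0) : ψ (-a) = ψ a := by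
  simpa using h.ac2 (-1) a (by norm_num) ha

theorem psi_sub_comm (h : IsHCouple ψ) {a b : Γ} (hab : a ≠ b) : ψ (a - b) = ψ (b - a) := by
  rw [← neg_sub b a, h.psi_neg (sub_ne_zero.2 hab.symm)]

theorem psi_abs (h : IsHCouple ψ) {a : Γ} (ha : a ≠ 0) : ψ |a| = ψ a := by
  rcases abs_choice a with h1 | h1 <;> rw [h1]
  exact h.psi_neg ha

theorem psi_le_of_abs_le (h : IsHCouple ψ) {a b : Γ} (ha : a ≠ 0) (hab : |a| ≤ |b|) :
    ψ b ≤ ψ a := by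
  have hb : b ≠ 0 := by
    rintro rfl
    simp at hab
    exact ha hab
  have := h.hc |a| |b| (abs_pos.2 ha) hab
  rwa [h.psi_abs ha, h.psi_abs hb] at this

/-- The disjunction `a = 0 ∨ ψ b < ψ a` expresses `ψ b < ψ a` under the convention `ψ 0 = ∞`; it
recurs in this form below. The bound is the contrapositive of convexity (HC). -/
theorem abs_lt_of_psi_lt (h : IsHCouple ψ) {a b : Γ} (ha : a = 0 ∨ ψ b < ψ a) (hb : b ≠ 0) :
    |a| < |b| := by
  rcases ha with rfl | ha
  · simpa using hb
  · by_contra! hc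
    exact absurd (h.psi_le_of_abs_le hb hc) (not_le.2 ha)

theorem add_ne_zero (h : IsHCouple ψ) {a b : Γ} (ha : a ≠ 0) (hb : b = 0 ∨ ψ a < ψ b) :
    a + b ≠ 0 := by
  intro h0
  have := h.abs_lt_of_psi_lt hb ha
  rw [eq_neg_of_add_eq_zero_left h0, abs_neg] at this
  exact lt_irrefl _ this

theorem psi_add (h : IsHCouple ψ) {a b : Γ} (ha : a ≠ 0) (hb : b = 0 ∨ ψ a < ψ b) :
    ψ (a + b) = ψ a := by
  rcases eq_or_ne b 0 with rfl | hb0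
  · rw [add_zero]
  have hlt := hb.resolve_left hb0
  have hab := h.add_ne_zero ha hb
  apply le_antisymm
  · have := h.ac1 (a + b) (-b) hab (neg_ne_zero.2 hb0) (by simpa using ha)
    rw [add_neg_cancel_right, h.psi_neg hb0] at this
    rcases min_le_iff.1 this with h1 | h1
    · exact h1
    · exact absurd h1 (not_le.2 hlt)
  · have := h.ac1 a b ha hb0 hab
    rwa [min_eq_left hlt.le] at this

theorem psi_sub (h : IsHCouple ψ) {a b : Γ} (ha : a ≠ 0) (hb : b = 0 ∨ ψ a < ψ b) :
    ψ (a - b) = ψ a := by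
  rw [sub_eq_add_neg]
  refine h.psi_add ha ?_
  rcases eq_or_ne b 0 with rfl | hb0
  · simp
  · rw [h.psi_neg hb0]
    exact Or.inr (hb.resolve_left hb0)

/-- The summand of smaller `ψ`-value has larger absolute value, so it decides the sign. -/
theorem pos_add_iff (h : IsHCouple ψ) {a b : Γ} (ha : a ≠ 0) (hb : b = 0 ∨ ψ a < ψ b) :
    0 < a + b ↔ 0 < a := by
  have h1 := h.abs_lt_of_psi_lt hb ha
  obtain ⟨h2, h3⟩ := abs_lt.1 h1
  constructor
  · intro h4
    by_contra! h5
    rw [abs_of_nonpos h5] at h3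
    exact absurd h4 (not_lt.2 (by simpa using add_le_add_right h3.le a))
  · intro h4
    rw [abs_of_pos h4] at h2
    simpa using add_lt_add_right h2 a

/-- The map `ψ` is contracting. -/
theorem psi_lt_psi_sub (h : IsHCouple ψ) {a b : Γ} (ha : a ≠ 0) (hb : b ≠ 0) (hab : ψ a < ψ b) :
    ψ a < ψ (ψ b - ψ a) := by
  have hd : 0 < ψ b - ψ a := sub_pos.2 hab
  -- (AC3) gives `0 < ψ b - ψ a < |a|`, hence `≤` by convexity. Equality is impossible, since (AC3)
  -- for `ψ b - ψ a` itself would then read `ψ b < ψ b`.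
  have h1 := h.ac3 |a| b hb (abs_pos.2 ha)
  rw [h.psi_abs ha] at h1
  have h2 : |ψ b - ψ a| ≤ |a| := by
    rw [abs_of_pos hd]
    exact (sub_lt_iff_lt_add.2 h1).le
  refine lt_of_le_of_ne (h.psi_le_of_abs_le hd.ne' h2) fun h3 => ?_
  have h4 := h.ac3 _ b hb hd
  rw [← h3, sub_add_cancel] at h4
  exact lt_irrefl _ h4

/-- `ψ(ψ(x) - a)` is larger than `ψ(x)` as soon as it is not attained on `a - ψ(e)`. -/
theorem psi_lt_psi_psi_sub (h : IsHCouple ψ) {x e a : Γ} (hx : x ≠ 0) (he : e ≠ 0)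
    (hlt : ψ x < ψ e) (hxa : ψ x ≠ a) (hne : a ≠ ψ e → ψ (ψ x - a) ≠ ψ (a - ψ e)) :
    ψ x < ψ (ψ x - a) := by
  have h1 := h.psi_lt_psi_sub hx he hlt
  rw [h.psi_sub_comm hlt.ne'] at h1
  rcases eq_or_ne a (ψ e) with rfl | hae
  · exact h1
  -- Were `ψ (ψ x - a)` below `ψ (ψ x - ψ e)`, it would equal the value of the difference `ψ e - a`,
  -- which `hne` forbids.
  refine lt_of_lt_of_le h1 ?_
  by_contra! hc
  have h2 : ψ x - ψ e ≠ 0 := sub_ne_zero.2 hlt.ne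
  have h3 := h.psi_sub (sub_ne_zero.2 hxa) (Or.inr hc)
  rw [show ψ x - a - (ψ x - ψ e) = ψ e - a by abel, h.psi_sub_comm hae.symm] at h3
  exact hne hae h3.symm

/-- An element in the gap between `ψ(e)` and `e'` for small `e`: the value of `ψ` at its
differences with derivatives. -/
theorem psi_sub_add_psi (h : IsHCouple ψ) {x d e : Γ} (hd : d ≠ 0) (he : 0 < e) (hde : ψ d < ψ e)
    (h1 : ψ e < x) (h2 : x < e + ψ e) : ψ (x - (d + ψ d)) = ψ d := by
  have h3 : ψ e ≤ ψ (x - ψ e) := by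
    refine h.hc _ _ (sub_pos.2 h1) (sub_lt_iff_lt_add.2 h2).le
  have h4 := h.psi_lt_psi_sub hd he.ne' hde
  have h6 : ψ d < ψ (x - ψ d) := by
    have h5 := h.ac1 (x - ψ e) (ψ e - ψ d) (sub_pos.2 h1).ne' (sub_pos.2 hde).ne'
      (by simpa using (sub_pos.2 (hde.trans h1)).ne')
    rw [sub_add_sub_cancel] at h5
    exact lt_of_lt_of_le (lt_min (hde.trans_le h3) h4) h5
  -- Since `ψ d < ψ (x - ψ d)`, the term `d` dominates.
  rw [show x - (d + ψ d) = -(d - (x - ψ d)) by abel, h.psi_neg, h.psi_sub hd (Or.inr h6)]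
  rw [sub_eq_add_neg]
  refine h.add_ne_zero hd (Or.inr ?_)
  rwa [h.psi_neg (sub_pos.2 (hde.trans h1)).ne']

/-- Suppose `d = z - ψ e > 0`. If `ψ d = ψ e`, then `z` is the derivative of `d`; if `ψ d < ψ e`,
then `d > |e|` and `z` exceeds the derivative of `|e|`. Both put `z` outside `P`, so for such `z`
the cut reduces to a comparison in the order. -/
theorem mem_cut_iff (h : IsHCouple ψ) {P : Set Γ} (hP : IsHCut ψ P) {z e : Γ} (he : e ≠ 0)
    (hz : z ≠ ψ e → ψ (z - ψ e) ≤ ψ e) : z ∈ P ↔ z ≤ ψ e := by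
  have hPe : ψ e ∈ P := hP.psiSet_subset ⟨e, he, rfl⟩
  refine ⟨fun hzP => ?_, fun hle => hP.isLowerSet hle hPe⟩
  by_contra! hlt
  have hd : 0 < z - ψ e := sub_pos.2 hlt
  rcases (hz hlt.ne').eq_or_lt with h1 | h1
  · have := hP.lt_deriv z hzP _ hd
    rw [h1, sub_add_cancel] at this
    exact lt_irrefl _ this
  · have h2 := h.abs_lt_of_psi_lt (Or.inr h1) hd.ne'
    rw [abs_of_pos hd, lt_sub_iff_add_lt] at h2
    have h3 := hP.lt_deriv _ (hP.isLowerSet h2.le hzP) |e| (abs_pos.2 he)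
    rw [h.psi_abs he] at h3
    exact lt_irrefl _ h3

end IsHCouple

theorem IsHCut.psi_mem {P : Set Γ} (hP : IsHCut ψ P) {a : Γ} (ha : a ≠ 0) : ψ a ∈ P :=
  hP.psiSet_subset ⟨a, ha, rfl⟩

/-- This is what makes `P` indispensable in the language: it decides the sign of an integral. -/
theorem IsHCut.add_psi_mem_iff {P : Set Γ} (hP : IsHCut ψ P) {a : Γ} (ha : a ≠ 0) :
    a + ψ a ∈ P ↔ a < 0 := by
  constructor
  · intro h
    by_contra! hc
    exact lt_irrefl _ (hP.lt_deriv _ h a (lt_of_le_of_ne hc ha.symm))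
  · intro h
    exact hP.isLowerSet (by simpa using h.le) (hP.psi_mem ha)

/-- In a closed H-couple the only H-cut is `Ψ`. -/
theorem IsClosedCouple.exists_psi_eq (hc : IsClosedCouple ψ) (h : IsHCouple ψ) {P : Set Γ}
    (hP : IsHCut ψ P) {b : Γ} (hb : b ∈ P) : ∃ x, 0 < x ∧ ψ x = b := by
  obtain ⟨a, ha, rfl⟩ := hc.asymptoticIntegration b
  have h1 : a + ψ a < ψ a := by simpa using (hP.add_psi_mem_iff ha).1 hb
  obtain ⟨x, hx, hxb⟩ := hc.isLowerSet_psiSet h1.le ⟨a, ha, rfl⟩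
  exact ⟨|x|, abs_pos.2 hx, by rw [h.psi_abs hx, hxb]⟩

/-- By contraction `ψ a - ψ b` has value above `ψ b`, as does `a`; their sum is therefore smaller
than `|b|`. -/
theorem IsHCouple.add_psi_lt (h : IsHCouple ψ) {a b : Γ} (ha : 0 < a) (hb : b ≠ 0)
    (hab : ψ b < ψ a) : a + ψ a < |b| + ψ b := by
  have hd : 0 < ψ a - ψ b := sub_pos.2 hab
  have hw : 0 < a + (ψ a - ψ b) := by positivity
  have h1 := h.ac1 a (ψ a - ψ b) ha.ne' hd.ne' hw.ne'
  have h2 := lt_of_lt_of_le (lt_min hab (h.psi_lt_psi_sub hb ha.ne' hab)) h1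
  have h3 := h.abs_lt_of_psi_lt (Or.inr h2) hb
  rw [abs_of_pos hw, ← add_sub_assoc] at h3
  exact sub_lt_iff_lt_add.1 h3

end Basic

section Smul

variable {k : Type*} [Field k] [LinearOrder k] [IsStrictOrderedRing k]
  {Γ : Type*} [AddCommGroup Γ] [LinearOrder Γ] [IsOrderedAddMonoid Γ]
  [Module k Γ] [PosSMulStrictMono k Γ] {ψ : Γ → Γ}

/-- The derivative of an element outside a substructure `A`, when it lies in `A`. -/
theorem IsHCouple.psi_lt_of_add_psi_mem_submodule (h : IsHCouple ψ) {A : Submodule k Γ}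
    (hA : ∀ a ∈ A, a ≠ 0 → ψ a ∈ A) {x : Γ} (hx : x ≠ 0) (hxA : x ∉ A) (hb : x + ψ x ∈ A)
    {a : Γ} (ha : a ∈ A) (ha0 : a ≠ 0) : ψ a < ψ x := by
  have hψx : ψ x ∉ A := fun hm => hxA (by simpa using A.sub_mem hb hm)
  by_contra! hle
  have hlt : ψ x < ψ a := lt_of_le_of_ne hle fun he => hψx (he ▸ hA a ha ha0)
  have h1 := h.psi_lt_psi_sub hx ha0 hlt
  have h2 := h.psi_sub hx (Or.inr h1)
  have h3 := h.add_ne_zero hx (b := -(ψ a - ψ x))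
    (Or.inr (by rwa [h.psi_neg (sub_pos.2 hlt).ne']))
  rw [← sub_eq_add_neg] at h3
  -- By contraction `x - (ψ a - ψ x)` still has value `ψ x`; but it equals `x + ψ x - ψ a`, an
  -- element of `A`, which forces `ψ x ∈ A`.
  refine hψx (h2 ▸ hA _ ?_ h3)
  rw [show x - (ψ a - ψ x) = x + ψ x - ψ a by abel]
  exact A.sub_mem hb (hA a ha ha0)

end Smul

/-! ### Partial isomorphisms between H-triples, represented by their graphs -/

section Graph

variable {k : Type*} [Field k] [LinearOrder k] [IsStrictOrderedRing k]
  {M : Type*} [AddCommGroup M] [LinearOrder M] [IsOrderedAddMonoid M]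
  [Module k M] [PosSMulStrictMono k M]
  {N : Type*} [AddCommGroup N] [LinearOrder N] [IsOrderedAddMonoid N]
  [Module k N] [PosSMulStrictMono k N]
  {ψ : M → M} {P : Set M} {ψ₁ : N → N} {P₁ : Set N} {G : Submodule k (M × N)}

/-- `G` is the graph of an isomorphism between ordered subspaces of `M` and `N`. -/
def IsOrderGraph (G : Submodule k (M × N)) : Prop := ∀ p ∈ G, 0 < p.1 ↔ 0 < p.2

namespace IsOrderGraph

theorem lt_iff (hG : IsOrderGraph G) {p q : M × N} (hp : p ∈ G) (hq : q ∈ G) :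
    p.1 < q.1 ↔ p.2 < q.2 := by
  simpa using hG (q - p) (G.sub_mem hq hp)

theorem le_iff (hG : IsOrderGraph G) {p q : M × N} (hp : p ∈ G) (hq : q ∈ G) :
    p.1 ≤ q.1 ↔ p.2 ≤ q.2 := by
  rw [← not_lt, ← not_lt, hG.lt_iff hq hp]

theorem eq_iff (hG : IsOrderGraph G) {p q : M × N} (hp : p ∈ G) (hq : q ∈ G) :
    p.1 = q.1 ↔ p.2 = q.2 := by
  rw [le_antisymm_iff, le_antisymm_iff, hG.le_iff hp hq, hG.le_iff hq hp]

theorem eq_zero_iff (hG : IsOrderGraph G) {p : M × N} (hp : p ∈ G) : p.1 = 0 ↔ p.2 = 0 :=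
  hG.eq_iff hp G.zero_mem

theorem lt_zero_iff (hG : IsOrderGraph G) {p : M × N} (hp : p ∈ G) : p.1 < 0 ↔ p.2 < 0 :=
  hG.lt_iff hp G.zero_mem

end IsOrderGraph

/-! ### Adjoining one pair to an order isomorphism -/

theorem mem_sup_span {E : Type*} [AddCommGroup E] [Module k E] {G : Submodule k E} {p q : E} :
    p ∈ G ⊔ Submodule.span k {q} ↔ ∃ g ∈ G, ∃ c : k, g + c • q = p := by
  simp only [Submodule.mem_sup, Submodule.mem_span_singleton, exists_exists_eq_and]

theorem smul_pos_congr {c : k} {x : M} {y : N} (hxy : 0 < x ↔ 0 < y) (hx : x ≠ 0) (hy : y ≠ 0) :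
    0 < c • x ↔ 0 < c • y := by
  have hneg : x < 0 ↔ y < 0 := by
    rw [← not_le, ← not_le, hx.symm.le_iff_lt, hy.symm.le_iff_lt, hxy]
  rcases lt_trichotomy c 0 with hc | rfl | hc
  · rw [smul_pos_iff_of_neg_left hc, smul_pos_iff_of_neg_left hc, hneg]
  · simp
  · rw [smul_pos_iff_of_pos_left hc, smul_pos_iff_of_pos_left hc, hxy]

/-- Adjoining an element whose `ψ`-value is new. -/
theorem isOrderGraph_sup_span (h : IsHCoupleOver k ψ) (h₁ : IsHCoupleOver k ψ₁)
    (hG : IsOrderGraph G) {V : Set (M × N)}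
    (hV : ∀ p ∈ G, p.1 ≠ 0 → (ψ p.1, ψ₁ p.2) ∈ V) {x : M} {y : N} (hx : x ≠ 0) (hy : y ≠ 0)
    (hxy : 0 < x ↔ 0 < y)
    (hcut : ∀ v ∈ V, v.1 ≠ ψ x ∧ v.2 ≠ ψ₁ y ∧ (v.1 < ψ x ↔ v.2 < ψ₁ y)) :
    IsOrderGraph (G ⊔ Submodule.span k {(x, y)}) ∧
      ∀ p ∈ G ⊔ Submodule.span k {(x, y)}, p.1 ≠ 0 →
        (ψ p.1, ψ₁ p.2) ∈ insert (ψ x, ψ₁ y) V := by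
  rw [IsOrderGraph, ← forall₂_and]
  intro p hp
  obtain ⟨g, hg, c, rfl⟩ := mem_sup_span.1 hp
  rcases eq_or_ne c 0 with rfl | hc
  · simp only [zero_smul, add_zero]
    exact ⟨hG g hg, fun h0 => Or.inr (hV g hg h0)⟩
  have hz : c • x ≠ 0 := smul_ne_zero hc hx
  have hw : c • y ≠ 0 := smul_ne_zero hc hy
  have hpos : 0 < c • x ↔ 0 < c • y := smul_pos_congr hxy hx hy
  simp only [Prod.fst_add, Prod.snd_add, Prod.smul_mk]
  rcases eq_or_ne g.1 0 with hg0 | hg0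
  · rw [hg0, (hG.eq_zero_iff hg).1 hg0, zero_add, zero_add, h.psi_smul c x hc hx,
      h₁.psi_smul c y hc hy]
    exact ⟨hpos, fun _ => Or.inl rfl⟩
  have hg1 : g.2 ≠ 0 := fun h0 => hg0 ((hG.eq_zero_iff hg).2 h0)
  obtain ⟨n1, n2, n3⟩ := hcut _ (hV g hg hg0)
  dsimp only at n1 n2 n3
  rw [← h.psi_smul c x hc hx] at n1 n3 ⊢
  rw [← h₁.psi_smul c y hc hy] at n2 n3 ⊢
  -- The two summands have different values, in the same order on both sides, so the same summand
  -- determines sign and value in `M` and in `N`.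
  rcases n1.lt_or_gt with hlt | hlt
  · have hlt' := n3.1 hlt
    rw [h.psi_add hg0 (Or.inr hlt), h₁.psi_add hg1 (Or.inr hlt'), h.pos_add_iff hg0 (Or.inr hlt),
      h₁.pos_add_iff hg1 (Or.inr hlt')]
    exact ⟨hG g hg, fun _ => Or.inr (hV g hg hg0)⟩
  · have hlt' : ψ₁ (c • y) < ψ₁ g.2 :=
      lt_of_le_of_ne (not_lt.1 fun hc => absurd (n3.2 hc) hlt.not_gt) n2.symm
    rw [add_comm g.1, add_comm g.2, h.psi_add hz (Or.inr hlt), h₁.psi_add hw (Or.inr hlt'),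
      h.pos_add_iff hz (Or.inr hlt), h₁.pos_add_iff hw (Or.inr hlt')]
    exact ⟨hpos, fun _ => Or.inl rfl⟩

/-- Adjoining an element for which the translates by `G` have prescribed signs and values. -/
theorem isOrderGraph_sup_span_of_translates (h : IsHCoupleOver k ψ) (h₁ : IsHCoupleOver k ψ₁)
    (hG : IsOrderGraph G) {V : Set (M × N)}
    (hV : ∀ p ∈ G, p.1 ≠ 0 → (ψ p.1, ψ₁ p.2) ∈ V) {x : M} {y : N}
    (hxy : ∀ g ∈ G, x - g.1 ≠ 0 ∧ y - g.2 ≠ 0 ∧ (0 < x - g.1 ↔ 0 < y - g.2) ∧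
      (ψ (x - g.1), ψ₁ (y - g.2)) ∈ V) :
    IsOrderGraph (G ⊔ Submodule.span k {(x, y)}) ∧
      ∀ p ∈ G ⊔ Submodule.span k {(x, y)}, p.1 ≠ 0 → (ψ p.1, ψ₁ p.2) ∈ V := by
  rw [IsOrderGraph, ← forall₂_and]
  intro p hp
  obtain ⟨g, hg, c, rfl⟩ := mem_sup_span.1 hp
  rcases eq_or_ne c 0 with rfl | hc
  · simp only [zero_smul, add_zero]
    exact ⟨hG g hg, fun h0 => hV g hg h0⟩
  -- For `c ≠ 0`, `g + c • (x, y)` is `c` times a translate of `(x, y)` by an element of `G`.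
  have hg' : -(c⁻¹ • g) ∈ G := G.neg_mem (G.smul_mem _ hg)
  obtain ⟨n1, n2, n3, n4⟩ := hxy _ hg'
  have e1 : (g + c • (x, y)).1 = c • (x - (-(c⁻¹ • g)).1) := by
    simp [smul_add, smul_smul, hc, add_comm]
  have e2 : (g + c • (x, y)).2 = c • (y - (-(c⁻¹ • g)).2) := by
    simp [smul_add, smul_smul, hc, add_comm]
  rw [e1, e2, h.psi_smul c _ hc n1, h₁.psi_smul c _ hc n2]
  exact ⟨smul_pos_congr n3 n1 n2, fun _ => n4⟩

/-- `G` is the graph of an isomorphism between substructures of two H-triples. -/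
structure IsIsoGraph (ψ : M → M) (P : Set M) (ψ₁ : N → N) (P₁ : Set N)
    (G : Submodule k (M × N)) : Prop where
  order : IsOrderGraph G
  psi_mem : ∀ p ∈ G, p.1 ≠ 0 → (ψ p.1, ψ₁ p.2) ∈ G
  cut_iff : ∀ p ∈ G, p.1 ∈ P ↔ p.2 ∈ P₁

/-- By `mem_cut_iff` on both sides, membership in the cuts becomes comparison with `ψ e.1` and `ψ₁
e.2`, which `G` preserves. -/
theorem IsOrderGraph.cut_iff_of_psi_sub_le (hG : IsOrderGraph G)
    (hψ : ∀ p ∈ G, p.1 ≠ 0 → (ψ p.1, ψ₁ p.2) ∈ G) (h : IsHTriple k ψ P) (h₁ : IsHTriple k ψ₁ P₁)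
    {p e : M × N} (hp : p ∈ G) (he : e ∈ G) (he0 : e.1 ≠ 0)
    (hpe : p.1 ≠ ψ e.1 → ψ (p.1 - ψ e.1) ≤ ψ e.1) : p.1 ∈ P ↔ p.2 ∈ P₁ := by
  have hψe := hψ e he he0
  rw [h.couple.mem_cut_iff h.cut he0 hpe,
    h₁.couple.mem_cut_iff h₁.cut (fun h0 => he0 ((hG.eq_zero_iff he).2 h0)), hG.le_iff hp hψe]
  intro hne
  have hne' : p.1 ≠ ψ e.1 := fun h0 => hne ((hG.eq_iff hp hψe).1 h0)
  have hd := G.sub_mem hp hψe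
  exact (hG.le_iff (hψ _ hd (sub_ne_zero.2 hne')) hψe).1 (hpe hne')

/-- An element outside the gap of `e` is at most a value of `ψ` (hence in the cut) or at least the
derivative of a positive element (hence not in it), and both facts transfer along `G`. -/
theorem IsOrderGraph.cut_iff_of_bound (hG : IsOrderGraph G)
    (hψ : ∀ p ∈ G, p.1 ≠ 0 → (ψ p.1, ψ₁ p.2) ∈ G) (h : IsHTriple k ψ P) (h₁ : IsHTriple k ψ₁ P₁)
    {p : M × N} (hp : p ∈ G)
    (hb : ∃ e ∈ G, e.1 ≠ 0 ∧ (p.1 ≤ ψ e.1 ∨ |e.1| + ψ e.1 ≤ p.1)) : p.1 ∈ P ↔ p.2 ∈ P₁ := by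
  obtain ⟨e, he, he0, hpe⟩ := hb
  wlog hpos : 0 < e.1 generalizing e
  · have h2 : (-e).1 ≠ 0 := neg_ne_zero.2 he0
    refine this (-e) (G.neg_mem he) h2 ?_ (neg_pos.2 (lt_of_le_of_ne (not_lt.1 hpos) he0))
    rwa [Prod.fst_neg, abs_neg, h.couple.psi_neg he0]
  have he1 := (hG e he).1 hpos
  have hψe := hψ e he he0
  rcases hpe with hpe | hpe
  · refine iff_of_true (h.cut.isLowerSet hpe (h.cut.psi_mem he0)) ?_
    exact h₁.cut.isLowerSet ((hG.le_iff hp hψe).1 hpe) (h₁.cut.psi_mem he1.ne')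
  · rw [abs_of_pos hpos] at hpe
    refine iff_of_false (fun hm => ?_) (fun hm => ?_)
    · exact absurd (h.cut.lt_deriv _ hm _ hpos) (not_lt.2 hpe)
    · exact absurd (h₁.cut.lt_deriv _ hm _ he1)
        (not_lt.2 ((hG.le_iff (G.add_mem he hψe) hp).1 hpe))

/-- The pairs of corresponding `ψ`-values. -/
def valueSet (ψ : M → M) (ψ₁ : N → N) (G : Submodule k (M × N)) : Set (M × N) :=
  {v | ∃ p ∈ G, p.1 ≠ 0 ∧ (ψ p.1, ψ₁ p.2) = v}

theorem mem_valueSet {p : M × N} (hp : p ∈ G) (h0 : p.1 ≠ 0) :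
    (ψ p.1, ψ₁ p.2) ∈ valueSet ψ ψ₁ G := ⟨p, hp, h0, rfl⟩

namespace IsIsoGraph

theorem snd_psi_mem (hG : IsIsoGraph ψ P ψ₁ P₁ G) {y : N} (hy : y ∈ G.map (LinearMap.snd k M N))
    (hy0 : y ≠ 0) : ψ₁ y ∈ G.map (LinearMap.snd k M N) := by
  obtain ⟨p, hp, rfl⟩ := hy
  exact ⟨_, hG.psi_mem p hp fun h0 => hy0 ((hG.order.eq_zero_iff hp).1 h0), rfl⟩

theorem fst_psi_mem (hG : IsIsoGraph ψ P ψ₁ P₁ G) {x : M} (hx : x ∈ G.map (LinearMap.fst k M N))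
    (hx0 : x ≠ 0) : ψ x ∈ G.map (LinearMap.fst k M N) := by
  obtain ⟨p, hp, rfl⟩ := hx
  exact ⟨_, hG.psi_mem p hp hx0, rfl⟩

end IsIsoGraph

/-- A partial isomorphism between H-triples without proper extension. -/
structure IsMaximalIsoGraph (ψ : M → M) (P : Set M) (ψ₁ : N → N) (P₁ : Set N)
    (G : Submodule k (M × N)) : Prop extends IsIsoGraph ψ P ψ₁ P₁ G where
  maximal : ∀ G', IsIsoGraph ψ P ψ₁ P₁ G' → G ≤ G' → G' ≤ G

/-! ### Closure properties of the domain of a maximal partial isomorphism -/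

namespace IsMaximalIsoGraph

theorem mem_of_isIsoGraph (hG : IsMaximalIsoGraph ψ P ψ₁ P₁ G) {q : M × N}
    (h : IsIsoGraph ψ P ψ₁ P₁ (G ⊔ Submodule.span k {q})) : q ∈ G :=
  hG.maximal _ h le_sup_left (Submodule.mem_sup_right (Submodule.mem_span_singleton_self q))

/-- The domain of a maximal partial isomorphism has asymptotic integration. -/
theorem exists_add_psi_eq (hG : IsMaximalIsoGraph ψ P ψ₁ P₁ G) (h : IsClosedHTriple k ψ P)
    (h₁ : IsClosedHTriple k ψ₁ P₁) {b : M × N} (hb : b ∈ G) :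
    ∃ a ∈ G, a.1 ≠ 0 ∧ a.1 + ψ a.1 = b.1 := by
  obtain ⟨x, hx, hxb⟩ := h.closed.asymptoticIntegration b.1
  obtain ⟨y, hy, hyb⟩ := h₁.closed.asymptoticIntegration b.2
  by_contra! hc
  have hxA : x ∉ G.map (LinearMap.fst k M N) := by
    rintro ⟨p, hp, rfl⟩
    exact hc p hp hx hxb
  have hyA : y ∉ G.map (LinearMap.snd k M N) := by
    rintro ⟨p, hp, rfl⟩
    have hp0 : p.1 ≠ 0 := fun h0 => hy ((hG.order.eq_zero_iff hp).1 h0)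
    exact hc p hp hp0 ((hG.order.eq_iff (G.add_mem hp (hG.psi_mem p hp hp0)) hb).2 hyb)
  -- Both missing integrals have values above all old ones, so `ψ x` and `ψ₁ y` realize
  -- corresponding cuts.
  have hlt : ∀ v ∈ valueSet ψ ψ₁ G, v.1 < ψ x ∧ v.2 < ψ₁ y := by
    rintro _ ⟨p, hp, hp0, rfl⟩
    refine ⟨h.couple.psi_lt_of_add_psi_mem_submodule (A := G.map (LinearMap.fst k M N))
      (fun a ha h0 => hG.fst_psi_mem ha h0) hx hxA (hxb ▸ ⟨b, hb, rfl⟩) ⟨p, hp, rfl⟩ hp0, ?_⟩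
    exact h₁.couple.psi_lt_of_add_psi_mem_submodule (A := G.map (LinearMap.snd k M N))
      (fun a ha h0 => hG.snd_psi_mem ha h0) hy hyA (hyb ▸ ⟨b, hb, rfl⟩) ⟨p, hp, rfl⟩
      fun h0 => hp0 ((hG.order.eq_zero_iff hp).2 h0)
  have hsign : 0 < x ↔ 0 < y := by
    have h3 : x < 0 ↔ y < 0 := by
      rw [← h.cut.add_psi_mem_iff hx, ← h₁.cut.add_psi_mem_iff hy, hxb, hyb, hG.cut_iff b hb]
    rw [← not_le, ← not_le, hx.le_iff_lt, hy.le_iff_lt, h3]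
  obtain ⟨hord, hval⟩ := isOrderGraph_sup_span h.couple h₁.couple hG.order
    (fun p hp h0 => mem_valueSet (ψ := ψ) (ψ₁ := ψ₁) hp h0) hx hy hsign
    fun v hv => ⟨(hlt v hv).1.ne, (hlt v hv).2.ne, iff_of_true (hlt v hv).1 (hlt v hv).2⟩
  set G' := G ⊔ Submodule.span k {(x, y)} with hG'
  have hle : G ≤ G' := le_sup_left
  have hxy : (x, y) ∈ G' := Submodule.mem_sup_right (Submodule.mem_span_singleton_self _)
  have hψ : ∀ p ∈ G', p.1 ≠ 0 → (ψ p.1, ψ₁ p.2) ∈ G' := by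
    intro p hp hp0
    rcases hval p hp hp0 with he | ⟨q, hq, hq0, he⟩
    · rw [he]
      have := G'.sub_mem (hle hb) hxy
      rwa [show b - (x, y) = (ψ x, ψ₁ y) from Prod.ext (by simp [← hxb]) (by simp [← hyb])] at this
    · rw [← he]
      exact hle (hG.psi_mem q hq hq0)
  refine hxA ⟨_, hG.mem_of_isIsoGraph ⟨hord, hψ, fun p hp => ?_⟩, rfl⟩
  -- The comparison element is `(x, y)` itself: no value occurring in `G'` exceeds `ψ x`.
  refine hord.cut_iff_of_psi_sub_le hψ h.toIsHTriple h₁.toIsHTriple hp hxy hx fun hne => ?_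
  rcases hval _ (G'.sub_mem hp (hψ _ hxy hx)) (sub_ne_zero.2 hne) with he | hv
  · exact (Prod.ext_iff.1 he).1.le
  · exact (hlt _ hv).1.le

/-- In the domain of a maximal partial isomorphism, `Ψ` has no largest element. -/
theorem exists_psi_gt (hG : IsMaximalIsoGraph ψ P ψ₁ P₁ G) (h : IsClosedHTriple k ψ P)
    (h₁ : IsClosedHTriple k ψ₁ P₁) {b : M × N} (hb : b ∈ G) (hbP : b.1 ∈ P) :
    ∃ e ∈ G, 0 < e.1 ∧ b.1 < ψ e.1 := by
  obtain ⟨a, ha, ha0, hab⟩ := hG.exists_add_psi_eq h h₁ hb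
  rw [← hab] at hbP ⊢
  have h2 := (h.cut.add_psi_mem_iff ha0).1 hbP
  -- Here `b.1 = a.1 + ψ a.1` with `a.1 < 0`, so it lies below `ψ a.1 = ψ (-a.1)`.
  refine ⟨-a, G.neg_mem ha, by simpa using h2, ?_⟩
  rw [Prod.fst_neg, h.couple.psi_neg ha0]
  simpa using h2

/-- The domain of a maximal partial isomorphism is closed under `ψ`-preimages. -/
theorem exists_psi_eq (hG : IsMaximalIsoGraph ψ P ψ₁ P₁ G) (h : IsClosedHTriple k ψ P)
    (h₁ : IsClosedHTriple k ψ₁ P₁) {b : M × N} (hb : b ∈ G) (hbP : b.1 ∈ P) :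
    ∃ a ∈ G, a.1 ≠ 0 ∧ ψ a.1 = b.1 := by
  obtain ⟨x, hx, hxb⟩ := h.closed.exists_psi_eq h.couple.toIsHCouple h.cut hbP
  obtain ⟨y, hy, hyb⟩ := h₁.closed.exists_psi_eq h₁.couple.toIsHCouple h₁.cut
    ((hG.cut_iff b hb).1 hbP)
  obtain ⟨e, he, he0, hbe⟩ := hG.exists_psi_gt h h₁ hb hbP
  by_contra! hc
  obtain ⟨hord, hval⟩ := isOrderGraph_sup_span h.couple h₁.couple hG.order
    (fun p hp h0 => mem_valueSet (ψ := ψ) (ψ₁ := ψ₁) hp h0) hx.ne' hy.ne' (iff_of_true hx hy) (by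
      rintro _ ⟨p, hp, hp0, rfl⟩
      have hψp := hG.psi_mem p hp hp0
      dsimp only
      rw [hxb, hyb]
      exact ⟨hc p hp hp0, fun h2 => hc p hp hp0 ((hG.order.eq_iff hψp hb).2 h2),
        hG.order.lt_iff hψp hb⟩)
  set G' := G ⊔ Submodule.span k {(x, y)} with hG'
  have hle : G ≤ G' := le_sup_left
  have hψ : ∀ p ∈ G', p.1 ≠ 0 → (ψ p.1, ψ₁ p.2) ∈ G' := by
    intro p hp hp0
    rcases hval p hp hp0 with h2 | ⟨q, hq, hq0, h2⟩
    · rw [h2, hxb, hyb]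
      exact hle hb
    · rw [← h2]
      exact hle (hG.psi_mem q hq hq0)
  refine hc _ (hG.mem_of_isIsoGraph ⟨hord, hψ, fun p hp => ?_⟩) hx.ne' hxb
  obtain ⟨g, hg, c, rfl⟩ := mem_sup_span.1 hp
  rcases eq_or_ne c 0 with rfl | hc0
  · simpa using hG.cut_iff g hg
  -- Compare with an old `e` such that `ψ e.1 > b.1`. As `b.1` is not a value on the old domain, `c
  -- • x` and `g.1 - ψ e.1` have different values, and the value of their sum is at most `b.1`.
  refine hord.cut_iff_of_psi_sub_le hψ h.toIsHTriple h₁.toIsHTriple hp (hle he) he0.ne'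
    fun hne => ?_
  have hψe := hG.psi_mem e he he0.ne'
  have hψz : ψ (c • x) = b.1 := by rw [h.couple.psi_smul c x hc0 hx.ne', hxb]
  have e1 : (g + c • (x, y)).1 - ψ e.1 = c • x + (g.1 - ψ e.1) := by
    rw [Prod.fst_add, Prod.smul_fst]
    abel
  rw [e1]
  have hz : c • x ≠ 0 := smul_ne_zero hc0 hx.ne'
  refine le_trans ?_ hbe.le
  rcases eq_or_ne (g.1 - ψ e.1) 0 with h0 | h0
  · rw [h0, add_zero, hψz]
  · have hne' := hc _ (G.sub_mem hg hψe) h0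
    rw [Prod.fst_sub] at hne'
    rcases hne'.lt_or_gt with h2 | h2
    · rw [add_comm, h.couple.psi_add h0 (Or.inr (by rwa [hψz]))]
      exact h2.le
    · rw [h.couple.psi_add hz (Or.inr (by rwa [hψz])), hψz]

/-- Finitely many elements of `Ψ` are exceeded by some element of `Ψ`. -/
theorem exists_psi_gt_finset (hG : IsMaximalIsoGraph ψ P ψ₁ P₁ G) (h : IsClosedHTriple k ψ P)
    (h₁ : IsClosedHTriple k ψ₁ P₁) (s : Finset (M × N)) (hs : ∀ p ∈ s, p ∈ G ∧ p.1 ≠ 0) :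
    ∃ e ∈ G, 0 < e.1 ∧ ∀ p ∈ s, ψ p.1 < ψ e.1 := by
  classical
  induction s using Finset.induction with
  | empty =>
    obtain ⟨a, ha, ha0, -⟩ := hG.exists_add_psi_eq h h₁ G.zero_mem
    obtain ⟨e, he, he0, -⟩ := hG.exists_psi_gt h h₁ (hG.psi_mem a ha ha0) (h.cut.psi_mem ha0)
    exact ⟨e, he, he0, by simp⟩
  | insert p s hps ih =>
    obtain ⟨e, he, he0, hes⟩ := ih fun q hq => hs q (Finset.mem_insert_of_mem hq)
    obtain ⟨hp, hp0⟩ := hs p (Finset.mem_insert_self p s)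
    by_cases hlt : ψ p.1 < ψ e.1
    · exact ⟨e, he, he0, Finset.forall_mem_insert _ _ _ |>.2 ⟨hlt, hes⟩⟩
    · obtain ⟨f, hf, hf0, hpf⟩ := hG.exists_psi_gt h h₁ (hG.psi_mem p hp hp0) (h.cut.psi_mem hp0)
      exact ⟨f, hf, hf0, Finset.forall_mem_insert _ _ _ |>.2
        ⟨hpf, fun q hq => (hes q hq).trans_le ((not_lt.1 hlt).trans hpf.le)⟩⟩

end IsMaximalIsoGraph

end Graph

/-! ### Saturated H-triples -/

section Saturation

variable {Γ : Type*} [AddCommGroup Γ] [LinearOrder Γ] {ψ : Γ → Γ} {P : Set Γ}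

/-- Unary maps composed from constants, subtraction and `ψ`. -/
inductive IsDefMap (ψ : Γ → Γ) : (Γ → Γ) → Prop
  | id : IsDefMap ψ fun z => z
  | const (c : Γ) : IsDefMap ψ fun _ => c
  | sub {f g : Γ → Γ} (hf : IsDefMap ψ f) (hg : IsDefMap ψ g) : IsDefMap ψ fun z => f z - g z
  | psi {f : Γ → Γ} (hf : IsDefMap ψ f) : IsDefMap ψ fun z => ψ (f z)

/-- Sets defined by quantifier-free conditions on maps satisfying `IsDefMap`. -/
inductive IsDefSet (ψ : Γ → Γ) (P : Set Γ) : Set Γ → Prop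
  | pos {f : Γ → Γ} (hf : IsDefMap ψ f) : IsDefSet ψ P {z | 0 < f z}
  | cut : IsDefSet ψ P P
  | compl {S : Set Γ} (hS : IsDefSet ψ P S) : IsDefSet ψ P Sᶜ
  | inter {S T : Set Γ} (hS : IsDefSet ψ P S) (hT : IsDefSet ψ P T) : IsDefSet ψ P (S ∩ T)

/-- Countable saturation for one-variable conditions. -/
def IsSaturated (ψ : Γ → Γ) (P : Set Γ) : Prop :=
  ∀ C : ℕ → Set Γ, (∀ n, IsDefSet ψ P (C n)) → (∀ n, ∃ z, ∀ i < n, z ∈ C i) → ∃ z, ∀ n, z ∈ C n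

theorem IsSaturated.exists_of_countable (h : IsSaturated ψ P) {ι : Type*} [Countable ι]
    {C : ι → Set Γ} (hC : ∀ i, IsDefSet ψ P (C i))
    (hfin : ∀ s : Finset ι, ∃ z, ∀ i ∈ s, z ∈ C i) : ∃ z, ∀ i, z ∈ C i := by
  classical
  rcases isEmpty_or_nonempty ι with hι | hι
  · exact ⟨0, fun i => isEmptyElim i⟩
  obtain ⟨f, hf⟩ := exists_surjective_nat ι
  obtain ⟨z, hz⟩ := h (fun n => C (f n)) (fun n => hC _) fun n => by
    obtain ⟨z, hz⟩ := hfin ((Finset.range n).image f)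
    exact ⟨z, fun i hi => hz _ (Finset.mem_image_of_mem f (Finset.mem_range.2 hi))⟩
  exact ⟨z, fun i => by
    obtain ⟨n, rfl⟩ := hf i
    exact hz n⟩

namespace IsDefSet

theorem iff_prop {S : Set Γ} (hS : IsDefSet ψ P S) (p : Prop) :
    IsDefSet ψ P {z | z ∈ S ↔ p} := by
  by_cases hp : p
  · simpa [hp] using hS
  · simp only [hp, iff_false]
    exact hS.compl

variable [IsOrderedAddMonoid Γ]

theorem lt {f g : Γ → Γ} (hf : IsDefMap ψ f) (hg : IsDefMap ψ g) :
    IsDefSet ψ P {z | f z < g z} := by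
  simpa using IsDefSet.pos (P := P) (hg.sub hf)

theorem eq {f g : Γ → Γ} (hf : IsDefMap ψ f) (hg : IsDefMap ψ g) :
    IsDefSet ψ P {z | f z = g z} := by
  convert ((lt (P := P) hf hg).compl).inter (lt (P := P) hg hf).compl using 1
  ext z
  simp [le_antisymm_iff, and_comm]

theorem ne {f g : Γ → Γ} (hf : IsDefMap ψ f) (hg : IsDefMap ψ g) :
    IsDefSet ψ P {z | f z ≠ g z} := (eq hf hg).compl

end IsDefSet

end Saturation

/-! ### Finite approximation, inside a subspace, of elements and chains outside it -/

section Approximation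

variable {k : Type*} [Field k] [LinearOrder k] [IsStrictOrderedRing k]
  {Γ : Type*} [AddCommGroup Γ] [LinearOrder Γ] [IsOrderedAddMonoid Γ]
  [Module k Γ] [PosSMulStrictMono k Γ] {ψ : Γ → Γ} {P : Set Γ}

theorem IsHCouple.le_psi_add (h : IsHCouple ψ) {a b c : Γ} (ha : a = 0 ∨ c ≤ ψ a)
    (hb : b = 0 ∨ c ≤ ψ b) : a + b = 0 ∨ c ≤ ψ (a + b) := by
  rcases eq_or_ne a 0 with rfl | ha0
  · simpa using hb
  rcases eq_or_ne b 0 with rfl | hb0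
  · simpa using ha
  refine or_iff_not_imp_left.2 fun hab => le_trans ?_ (h.ac1 a b ha0 hb0 hab)
  exact le_min (ha.resolve_left ha0) (hb.resolve_left hb0)

theorem IsHCouple.le_psi_sub (h : IsHCouple ψ) {a b c : Γ} (ha : a = 0 ∨ c ≤ ψ a)
    (hb : b = 0 ∨ c ≤ ψ b) : a - b = 0 ∨ c ≤ ψ (a - b) := by
  rw [sub_eq_add_neg]
  refine h.le_psi_add ha ?_
  rcases eq_or_ne b 0 with rfl | hb0
  · simp
  · rw [h.psi_neg hb0]
    exact Or.inr (hb.resolve_left hb0)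

/-- Approximating `x` relative to a finite set by an element in its vicinity. -/
theorem IsHCouple.approx_of_dist (h : IsHCouple ψ) {x l d a : Γ} (hl : l < x) (hd : 0 < d)
    (hψd : ψ d = ψ (x - l)) (ha : a ≠ x) (hmax : ψ (x - a) ≤ ψ (x - l))
    (h1 : a < x → ψ (x - a) = ψ (x - l) → a ≤ l)
    (h2 : x < a → ψ (x - a) = ψ (x - l) → d ≤ a - (l + d)) :
    l + d ≠ a ∧ (0 < l + d - a ↔ 0 < x - a) ∧ ψ (l + d - a) = ψ (x - a) := by
  have hxl : 0 < x - l := sub_pos.2 hl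
  -- If `a` is farther from `x` than `l` is, the error `d - (x - l)` is negligible against `x - a`.
  -- At equal distance, `l + d` stays at least `d` away from `a`, on the same side as `x`.
  rcases hmax.lt_or_eq with hlt | heq
  · have hxa : x - a ≠ 0 := sub_ne_zero.2 ha.symm
    have h3 : d - (x - l) = 0 ∨ ψ (x - a) < ψ (d - (x - l)) :=
      (h.le_psi_sub (Or.inr hψd.ge) (Or.inr le_rfl)).imp_right hlt.trans_le
    have e1 : l + d - a = x - a + (d - (x - l)) := by abel
    rw [e1, h.psi_add hxa h3, h.pos_add_iff hxa h3, ← sub_ne_zero, e1]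
    exact ⟨h.add_ne_zero hxa h3, Iff.rfl, rfl⟩
  · have h3 : l + d - a = 0 ∨ ψ (x - l) ≤ ψ (l + d - a) := by
      rw [show l + d - a = d + (x - a - (x - l)) by abel]
      exact h.le_psi_add (Or.inr hψd.ge) (h.le_psi_sub (Or.inr heq.ge) (Or.inr le_rfl))
    rcases ha.lt_or_gt with hax | hax
    · have h4 : d ≤ l + d - a := by
        have := h1 hax heq
        rw [add_sub_right_comm]
        exact le_add_of_nonneg_left (sub_nonneg.2 this)
      have h5 := hd.trans_le h4
      refine ⟨sub_ne_zero.1 h5.ne', iff_of_true h5 (sub_pos.2 hax), ?_⟩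
      rw [heq]
      exact le_antisymm (hψd ▸ h.hc _ _ hd h4) (h3.resolve_left h5.ne')
    · have h4 := h2 hax heq
      have h5 := hd.trans_le h4
      have h6 : l + d ≠ a := (sub_pos.1 h5).ne
      refine ⟨h6, iff_of_false (fun h7 => ?_) (fun h7 => ?_), ?_⟩
      · exact absurd (sub_pos.1 h7) (sub_pos.1 h5).not_gt
      · exact absurd (sub_pos.1 h7) hax.not_gt
      rw [heq]
      refine le_antisymm ?_ (h3.resolve_left (sub_ne_zero.2 h6))
      rw [h.psi_sub_comm h6, ← hψd]
      exact h.hc _ _ hd h4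

/-- If all values `ψ(x - a)` with `a ∈ A` are attained in `A`, then `x` can be approximated by
elements of `A`. -/
theorem IsHCoupleOver.exists_approx (h : IsHCoupleOver k ψ) {A : Submodule k Γ} {x : Γ}
    (hx : x ∉ A) (hA : ∀ a ∈ A, ∃ d ∈ A, d ≠ 0 ∧ ψ d = ψ (x - a)) (s : Finset Γ)
    (hs : ∀ a ∈ s, a ∈ A) :
    ∃ w ∈ A, ∀ a ∈ s, w ≠ a ∧ (0 < w - a ↔ 0 < x - a) ∧ ψ (w - a) = ψ (x - a) := by
  classical
  rcases s.eq_empty_or_nonempty with rfl | hne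
  · exact ⟨0, A.zero_mem, by simp⟩
  -- `m` is a point of `s` closest to `x` for the valuation; reflecting through `0` allows `m < x`.
  obtain ⟨m, hm, hmax⟩ := s.exists_max_image (fun a => ψ (x - a)) hne
  have hxne : ∀ a ∈ A, a ≠ x := fun a ha he => hx (he ▸ ha)
  wlog hmx : m < x generalizing x s m
  · have hmx' : x < m := lt_of_le_of_ne (not_lt.1 hmx) (hxne m (hs m hm)).symm
    have hneg : ∀ a ∈ A, ψ (-x - -a) = ψ (x - a) := fun a ha => by
      rw [show -x - -a = -(x - a) by abel, h.psi_neg (sub_ne_zero.2 (hxne a ha).symm)]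
    obtain ⟨w, hw, hws⟩ := this (x := -x) (by simpa using hx)
      (fun a ha => by
        have := hA (-a) (A.neg_mem ha)
        rwa [← hneg (-a) (A.neg_mem ha), neg_neg] at this)
      (s.image Neg.neg)
      (by
        intro a ha
        obtain ⟨b, hb, rfl⟩ := Finset.mem_image.1 ha
        exact A.neg_mem (hs b hb))
      (hne.image _) (-m) (Finset.mem_image_of_mem _ hm)
      (by
        intro a ha
        obtain ⟨b, hb, rfl⟩ := Finset.mem_image.1 ha
        rw [hneg b (hs b hb), hneg m (hs m hm)]
        exact hmax b hb)
      (fun a ha he => hx (by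
        have := A.neg_mem ha
        rwa [he, neg_neg] at this))
      (neg_lt_neg hmx')
    refine ⟨-w, A.neg_mem hw, fun a ha => ?_⟩
    obtain ⟨h1, h2, h3⟩ := hws (-a) (Finset.mem_image_of_mem _ ha)
    have h4 : -w ≠ a := fun he => h1 (by rw [← he, neg_neg])
    have h5 : x ≠ a := (hxne a (hs a ha)).symm
    have e1 : w - -a = -(-w - a) := by abel
    have e2 : -x - -a = -(x - a) := by abel
    rw [e1, e2, h.psi_neg (sub_ne_zero.2 h4), h.psi_neg (sub_ne_zero.2 h5)] at h3
    rw [e1, e2, neg_pos, neg_pos, ← not_le, ← not_le, (sub_ne_zero.2 h4).symm.le_iff_lt,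
      (sub_ne_zero.2 h5).symm.le_iff_lt, not_iff_not] at h2
    exact ⟨h4, h2, h3⟩
  obtain ⟨l, hl, hlmax⟩ := (s.filter fun a => a < x ∧ ψ (x - a) = ψ (x - m)).exists_max_image id
    ⟨m, Finset.mem_filter.2 ⟨hm, hmx, rfl⟩⟩
  obtain ⟨hls, hlx, hlm⟩ := Finset.mem_filter.1 hl
  -- `l` is the largest of the closest points below `x`. If some closest point lies above `x`, `d`
  -- is half the distance from `l` to the least such `r`; otherwise any positive `d ∈ A` of the
  -- right value will do.
  have key : ∃ d ∈ A, 0 < d ∧ ψ d = ψ (x - l) ∧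
      ∀ a ∈ s, x < a → ψ (x - a) = ψ (x - l) → d ≤ a - (l + d) := by
    rcases (s.filter fun a => x < a ∧ ψ (x - a) = ψ (x - m)).eq_empty_or_nonempty with he | hne'
    · obtain ⟨d, hd, hd0, hdψ⟩ := hA l (hs l hls)
      refine ⟨|d|, ?_, abs_pos.2 hd0, by rw [h.psi_abs hd0, hdψ], fun a ha hxa hψa => ?_⟩
      · rcases abs_choice d with h1 | h1 <;> rw [h1]
        exacts [hd, A.neg_mem hd]
      · have : a ∈ (∅ : Finset Γ) := he ▸ Finset.mem_filter.2 ⟨ha, hxa, hψa.trans hlm⟩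
        simp at this
    · obtain ⟨r, hr, hrmin⟩ := Finset.exists_min_image _ id hne'
      obtain ⟨hrs, hxr, hrm⟩ := Finset.mem_filter.1 hr
      have h2 : (2⁻¹ : k) ≠ 0 := by norm_num
      have hlr : 0 < r - l := sub_pos.2 (hlx.trans hxr)
      have hxl : 0 < x - l := sub_pos.2 hlx
      have hhalf : (2⁻¹ : k) • (r - l) + (2⁻¹ : k) • (r - l) = r - l := by
        rw [← add_smul, show (2⁻¹ + 2⁻¹ : k) = 1 by norm_num, one_smul]
      refine ⟨(2⁻¹ : k) • (r - l), A.smul_mem _ (A.sub_mem (hs r hrs) (hs l hls)),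
        smul_pos (by norm_num) hlr, ?_, fun a ha hxa hψa => ?_⟩
      · rw [h.psi_smul _ _ h2 hlr.ne']
        refine le_antisymm (h.hc _ _ hxl (sub_le_sub_right hxr.le l)) ?_
        have h3 : r - x = 0 ∨ ψ (x - l) ≤ ψ (r - x) :=
          Or.inr (by rw [h.psi_sub_comm hxr.ne', hrm, hlm])
        have h4 := (h.le_psi_add h3 (Or.inr le_rfl : x - l = 0 ∨ ψ (x - l) ≤ ψ (x - l)))
        rw [sub_add_sub_cancel] at h4
        exact h4.resolve_left hlr.ne'
      · have h3 : r ≤ a := hrmin a (Finset.mem_filter.2 ⟨ha, hxa, hψa.trans hlm⟩)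
        rw [← sub_sub, le_sub_iff_add_le, hhalf]
        exact sub_le_sub_right h3 l
  obtain ⟨d, hdA, hd, hψd, hdU⟩ := key
  refine ⟨l + d, A.add_mem (hs l hls) hdA, fun a ha => ?_⟩
  refine h.approx_of_dist hlx hd hψd (hxne a (hs a ha)) ?_ (fun h1 h2 => ?_) (hdU a ha)
  · rw [hlm]
    exact hmax a ha
  · exact hlmax a (Finset.mem_filter.2 ⟨ha, h1, h2.trans hlm⟩)

/-- The iterates `z ↦ ψ(z) - a₀ ↦ ψ(ψ(z) - a₀) - a₁ ↦ ⋯`. -/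
def chain (ψ : Γ → Γ) (a : ℕ → Γ) : ℕ → Γ → Γ
  | 0, z => z
  | i + 1, z => ψ (chain ψ a i z) - a i

/-- The recursion adds steps at the outer end, whereas the induction in `exists_chain_approx`
removes the first one. -/
theorem chain_succ_eq (a : ℕ → Γ) (i : ℕ) (z : Γ) :
    chain ψ a (i + 1) z = chain ψ (fun j => a (j + 1)) i (ψ z - a 0) := by
  induction i with
  | zero => rfl
  | succ i ih => rw [chain, ih, chain]

theorem isDefMap_chain (a : ℕ → Γ) (i : ℕ) : IsDefMap ψ (chain ψ a i) := by
  induction i with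
  | zero => exact IsDefMap.id
  | succ i ih => exact ih.psi.sub (.const _)

/-- A midpoint of the neighbours of `x` in `S` works; `e` guarantees an upper neighbour. Without a
lower one, subtracting `|d|` from the upper one suffices. -/
theorem exists_between_of_finset {A : Submodule k Γ} {d : Γ} (hd : d ∈ A) (hd0 : d ≠ 0)
    {x e : Γ} (hx : x ∉ A) (S : Finset Γ) (hS : ∀ s ∈ S, s ∈ A) (he : e ∈ S) (hxe : x < e) :
    ∃ b ∈ A, ∀ s ∈ S, s ≠ b ∧ (s < b ↔ s < x) := by
  classical
  obtain ⟨r, hr, hrmin⟩ := (S.filter fun s => x < s).exists_min_image id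
    ⟨e, Finset.mem_filter.2 ⟨he, hxe⟩⟩
  obtain ⟨hrS, hxr⟩ := Finset.mem_filter.1 hr
  suffices hb : ∃ b ∈ A, b < r ∧ ∀ s ∈ S, s < x → s < b by
    obtain ⟨b, hb, hbr, hSb⟩ := hb
    refine ⟨b, hb, fun s hs => ?_⟩
    have hsx : s ≠ x := fun h => hx (h ▸ hS s hs)
    rcases hsx.lt_or_gt with h1 | h1
    · exact ⟨(hSb s hs h1).ne, iff_of_true (hSb s hs h1) h1⟩
    · have h2 : b < s := hbr.trans_le (hrmin s (Finset.mem_filter.2 ⟨hs, h1⟩))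
      exact ⟨h2.ne', iff_of_false h2.not_gt h1.not_gt⟩
  rcases (S.filter fun s => s < x).eq_empty_or_nonempty with h0 | h0
  · refine ⟨r - |d|, A.sub_mem (hS r hrS) ?_, sub_lt_self _ (abs_pos.2 hd0), fun s hs hsx => ?_⟩
    · rcases abs_choice d with h1 | h1 <;> rw [h1]
      exacts [hd, A.neg_mem hd]
    · have : s ∈ (∅ : Finset Γ) := h0 ▸ Finset.mem_filter.2 ⟨hs, hsx⟩
      simp at this
  · obtain ⟨l, hl, hlmax⟩ := Finset.exists_max_image _ id h0
    obtain ⟨hlS, hlx⟩ := Finset.mem_filter.1 hl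
    have hlr : 0 < (2⁻¹ : k) • (r - l) := smul_pos (by norm_num) (sub_pos.2 (hlx.trans hxr))
    have hhalf : (2⁻¹ : k) • (r - l) + (2⁻¹ : k) • (r - l) = r - l := by
      rw [← add_smul, show (2⁻¹ + 2⁻¹ : k) = 1 by norm_num, one_smul]
    refine ⟨l + (2⁻¹ : k) • (r - l), A.add_mem (hS l hlS)
      (A.smul_mem _ (A.sub_mem (hS r hrS) (hS l hlS))), ?_, fun s hs hsx => ?_⟩
    · have := lt_add_of_pos_right ((2⁻¹ : k) • (r - l)) hlr
      rwa [hhalf, lt_sub_iff_add_lt'] at this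
    · exact (hlmax s (Finset.mem_filter.2 ⟨hs, hsx⟩) : s ≤ l).trans_lt (lt_add_of_pos_right _ hlr)

/-- Finite approximation of an infinite chain `y₀, y₁ = ψ(y₀) - a₀, …` with `ψ(yᵢ) ∉ A`. -/
theorem IsHTriple.exists_chain_approx (h : IsHTriple k ψ P) {A : Submodule k Γ}
    (hψ : ∀ a ∈ A, a ≠ 0 → ψ a ∈ A) (hsurj : ∀ b ∈ A, b ∈ P → ∃ d ∈ A, d ≠ 0 ∧ ψ d = b)
    (hcof : ∀ z, z ≠ 0 → ∃ e ∈ A, e ≠ 0 ∧ ψ z < ψ e) (n : ℕ) (y a : ℕ → Γ) (ha : ∀ i, a i ∈ A)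
    (hya : ∀ i, y (i + 1) = ψ (y i) - a i) (hy : ∀ i, y i ≠ 0) (hyA : ∀ i, ψ (y i) ∉ A)
    (S : Finset Γ) (hS : ∀ s ∈ S, s ∈ A) :
    ∃ w ∈ A, ∀ i ≤ n, chain ψ a i w ≠ 0 ∧ (0 < chain ψ a i w ↔ 0 < y i) ∧
      ∀ s ∈ S, s ≠ ψ (chain ψ a i w) ∧ (s < ψ (chain ψ a i w) ↔ s < ψ (y i)) := by
  classical
  -- An element of `A` below some `ψ e` lies in `P`, hence is a value of `ψ` on `A`, with a preimage
  -- of either sign.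
  have lift : ∀ {b y₀ : Γ}, b ∈ A → y₀ ≠ 0 → (∃ e ∈ A, e ≠ 0 ∧ b < ψ e) →
      ∃ w ∈ A, w ≠ 0 ∧ (0 < w ↔ 0 < y₀) ∧ ψ w = b := by
    rintro b y₀ hb hy₀ ⟨e, -, he0, hbe⟩
    obtain ⟨d, hd, hd0, rfl⟩ := hsurj b hb (h.cut.isLowerSet hbe.le (h.cut.psi_mem he0))
    have habs : |d| ∈ A := by
      rcases abs_choice d with h1 | h1 <;> rw [h1]
      exacts [hd, A.neg_mem hd]
    have hpos := abs_pos.2 hd0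
    rcases hy₀.lt_or_gt with h1 | h1
    · refine ⟨-|d|, A.neg_mem habs, neg_ne_zero.2 hpos.ne', iff_of_false ?_ h1.not_gt, ?_⟩
      · simp
      · rw [h.couple.psi_neg hpos.ne', h.couple.psi_abs hd0]
    · exact ⟨|d|, habs, hpos.ne', iff_of_true hpos h1, h.couple.psi_abs hd0⟩
  induction n generalizing y a S with
  | zero =>
    obtain ⟨e, he, he0, hye⟩ := hcof (y 0) (hy 0)
    obtain ⟨b, hb, hbS⟩ := exists_between_of_finset he he0 (hyA 0) (insert (ψ e) S)
      (Finset.forall_mem_insert _ _ _ |>.2 ⟨hψ e he he0, hS⟩) (Finset.mem_insert_self _ _) hye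
    obtain ⟨hbe, hbS⟩ := Finset.forall_mem_insert _ _ _ |>.1 hbS
    have hbe' : b < ψ e :=
      lt_of_le_of_ne (not_lt.1 fun h1 => (hbe.2.1 h1).not_gt hye) hbe.1.symm
    obtain ⟨w, hw, hw0, hwy, rfl⟩ := lift hb (hy 0) ⟨e, he, he0, hbe'⟩
    refine ⟨w, hw, fun i hi => ?_⟩
    obtain rfl := Nat.le_zero.1 hi
    exact ⟨hw0, hwy, hbS⟩
  | succ n ih =>
    obtain ⟨e, he, he0, hye⟩ := hcof (y 0) (hy 0)
    have hS' : ∀ s ∈ insert (ψ e) S, s ∈ A :=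
      Finset.forall_mem_insert _ _ _ |>.2 ⟨hψ e he he0, hS⟩
    -- The shifted chain is approximated over a larger finite set: controlling `w'` against the
    -- values `ψ (s - a 0)` makes it compare with `s - a 0` as `y 1` does, so that `w' + a 0`
    -- compares with `s` as `ψ (y 0)` does.
    obtain ⟨w', hw', hws⟩ := ih (fun i => y (i + 1)) (fun i => a (i + 1)) (fun i => ha _)
      (fun i => hya _) (fun i => hy _) (fun i => hyA _)
      (S ∪ ((insert (ψ e) S).filter fun s => s - a 0 ≠ 0).image fun s => ψ (s - a 0)) (by
        intro s hs
        rcases Finset.mem_union.1 hs with hs | hs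
        · exact hS s hs
        · obtain ⟨t, ht, rfl⟩ := Finset.mem_image.1 hs
          obtain ⟨ht, ht0⟩ := Finset.mem_filter.1 ht
          exact hψ _ (A.sub_mem (hS' t ht) (ha 0)) ht0)
    have h0 := hws 0 (Nat.zero_le n)
    simp only [chain, zero_add] at h0
    obtain ⟨hw0', hwy', hwS'⟩ := h0
    have key : ∀ s ∈ insert (ψ e) S, s ≠ w' + a 0 ∧ (s < w' + a 0 ↔ s < ψ (y 0)) := by
      intro s hs
      have e1 : w' + a 0 - s = w' - (s - a 0) := by abel
      have e2 : ψ (y 0) - s = y 1 - (s - a 0) := by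
        rw [hya 0]
        abel
      rw [← sub_pos, ← sub_pos (a := ψ (y 0)), ne_comm, ← sub_ne_zero, e1, e2]
      rcases eq_or_ne (s - a 0) 0 with h1 | h1
      · rw [h1, sub_zero, sub_zero]
        exact ⟨hw0', hwy'⟩
      have hneg : ψ (-(s - a 0)) = ψ (s - a 0) := h.couple.psi_neg h1
      have h1' : -(s - a 0) ≠ 0 := neg_ne_zero.2 h1
      obtain ⟨h2, h3⟩ := hwS' (ψ (s - a 0)) (Finset.mem_union_right _
        (Finset.mem_image_of_mem _ (Finset.mem_filter.2 ⟨hs, h1⟩)))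
      -- Since `ψ (y 1) ∉ A`, one of `y 1` and `s - a 0` strictly dominates, and its sign is the
      -- sign of their difference.
      have h4 : ψ (s - a 0) ≠ ψ (y 1) := fun h5 =>
        hyA 1 (h5 ▸ hψ _ (A.sub_mem (hS' s hs) (ha 0)) h1)
      rw [sub_eq_add_neg w', sub_eq_add_neg (y 1)]
      rcases h4.lt_or_gt with h5 | h5
      · have h6 := h3.2 h5
        rw [← hneg] at h5 h6
        rw [add_comm w', add_comm (y 1), h.couple.pos_add_iff h1' (Or.inr h5),
          h.couple.pos_add_iff h1' (Or.inr h6)]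
        exact ⟨h.couple.add_ne_zero h1' (Or.inr h6), Iff.rfl⟩
      · have h6 : ψ w' < ψ (s - a 0) :=
          lt_of_le_of_ne (not_lt.1 fun h7 => (h3.1 h7).not_gt h5) h2.symm
        rw [← hneg] at h5 h6
        rw [h.couple.pos_add_iff hw0' (Or.inr h6), h.couple.pos_add_iff (hy 1) (Or.inr h5)]
        exact ⟨h.couple.add_ne_zero hw0' (Or.inr h6), hwy'⟩
    obtain ⟨hbe, hbS⟩ := Finset.forall_mem_insert _ _ _ |>.1 key
    have hbe' : w' + a 0 < ψ e :=
      lt_of_le_of_ne (not_lt.1 fun h1 => (hbe.2.1 h1).not_gt hye) hbe.1.symm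
    obtain ⟨w, hw, hw0, hwy, hψw⟩ := lift (A.add_mem hw' (ha 0)) (hy 0) ⟨e, he, he0, hbe'⟩
    refine ⟨w, hw, fun i hi => ?_⟩
    cases i with
    | zero =>
      simp only [chain, hψw]
      exact ⟨hw0, hwy, hbS⟩
    | succ i =>
      rw [chain_succ_eq, hψw, add_sub_cancel_right]
      obtain ⟨h1, h2, h3⟩ := hws i (Nat.succ_le_succ_iff.1 hi)
      exact ⟨h1, h2, fun s hs => h3 s (Finset.mem_union_left _ hs)⟩

end Approximation

/-! ### Extending partial isomorphisms into a saturated closed H-triple -/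

section Extension

variable {k : Type*} [Field k] [LinearOrder k] [IsStrictOrderedRing k]
  {M : Type*} [AddCommGroup M] [LinearOrder M] [IsOrderedAddMonoid M]
  [Module k M] [PosSMulStrictMono k M]
  {N : Type*} [AddCommGroup N] [LinearOrder N] [IsOrderedAddMonoid N]
  [Module k N] [PosSMulStrictMono k N]
  {ψ : M → M} {P : Set M} {ψ₁ : N → N} {P₁ : Set N} {G : Submodule k (M × N)}

theorem IsOrderGraph.countable [Countable M] (hG : IsOrderGraph G) : Countable G :=
  Function.Injective.countable (f := fun p : G => p.1.1) fun p q hpq =>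
    Subtype.ext (Prod.ext hpq ((hG.eq_iff p.2 q.2).1 hpq))

namespace IsMaximalIsoGraph

/-- The domain of a maximal partial isomorphism into a saturated H-triple leaves no gap in `M`. -/
theorem exists_bound [Countable M] (hG : IsMaximalIsoGraph ψ P ψ₁ P₁ G)
    (h : IsClosedHTriple k ψ P) (h₁ : IsClosedHTriple k ψ₁ P₁) (hsat : IsSaturated ψ₁ P₁) (x : M) :
    ∃ e ∈ G, e.1 ≠ 0 ∧ (x ≤ ψ e.1 ∨ |e.1| + ψ e.1 ≤ x) := by
  classical
  by_contra! hgap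
  have := hG.order.countable
  obtain ⟨y, hy⟩ := hsat.exists_of_countable (ι := {p : G // p.1.1 ≠ 0})
    (C := fun p => {z | ψ₁ p.1.1.2 < z} ∩ {z | z < |p.1.1.2| + ψ₁ p.1.1.2} ∩
      {z | z ∈ P₁ ↔ x ∈ P})
    (fun p => ((IsDefSet.lt (.const _) .id).inter (IsDefSet.lt .id (.const _))).inter
      (IsDefSet.cut.iff_prop _)) (by
      intro s
      obtain ⟨e, he, he0, hes⟩ := hG.exists_psi_gt_finset h h₁ (s.image fun p => p.1.1) (by
        intro p hp
        obtain ⟨q, -, rfl⟩ := Finset.mem_image.1 hp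
        exact ⟨q.1.2, q.2⟩)
      have he1 := (hG.order e he).1 he0
      have hes' : ∀ p ∈ s, p.1.1.2 ≠ 0 ∧ ψ₁ p.1.1.2 < ψ₁ e.2 := fun p hp =>
        ⟨fun h0 => p.2 ((hG.order.eq_zero_iff p.1.2).2 h0),
          (hG.order.lt_iff (hG.psi_mem _ p.1.2 p.2) (hG.psi_mem e he he0.ne')).1
            (hes _ (Finset.mem_image_of_mem _ hp))⟩
      -- Any finite part of the gap contains both `ψ₁ e.2`, which is in the cut, and the derivative
      -- of `e.2`, which is not; choose whichever agrees with `x`.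
      by_cases hxP : x ∈ P
      · refine ⟨ψ₁ e.2, fun p hp => ⟨⟨(hes' p hp).2, ?_⟩,
          iff_of_true (h₁.cut.psi_mem he1.ne') hxP⟩⟩
        have := h₁.couple.ac3 |p.1.1.2| e.2 he1.ne' (abs_pos.2 (hes' p hp).1)
        rwa [h₁.couple.psi_abs (hes' p hp).1] at this
      · refine ⟨e.2 + ψ₁ e.2, fun p hp => ⟨⟨?_, ?_⟩, iff_of_false (fun hm => ?_) hxP⟩⟩
        · exact (hes' p hp).2.trans (lt_add_of_pos_left _ he1)
        · exact h₁.couple.add_psi_lt he1 (hes' p hp).1 (hes' p hp).2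
        · exact ((h₁.cut.add_psi_mem_iff he1.ne').1 hm).not_gt he1)
  have hylt : ∀ e ∈ G, e.1 ≠ 0 → ψ₁ e.2 < y ∧ y < |e.2| + ψ₁ e.2 := fun e he he0 =>
    (hy ⟨⟨e, he⟩, he0⟩).1
  obtain ⟨e₀, he₀, he₀0, -⟩ := hG.exists_psi_gt_finset h h₁ ∅ (by simp)
  have hyP : y ∈ P₁ ↔ x ∈ P := (hy ⟨⟨e₀, he₀⟩, he₀0.ne'⟩).2
  -- Write `g` as the derivative of some `d ∈ G`. Then `x - g.1` has value `ψ d.1` and sign opposite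
  -- to `d.1`, and likewise for `y`, so no new values arise.
  obtain ⟨hord, hval⟩ := isOrderGraph_sup_span_of_translates h.couple h₁.couple hG.order
    (fun p hp h0 => mem_valueSet (ψ := ψ) (ψ₁ := ψ₁) hp h0) (x := x) (y := y) (by
      intro g hg
      obtain ⟨d, hd, hd0, hdg⟩ := hG.exists_add_psi_eq h h₁ hg
      have hd1 : d.2 ≠ 0 := fun h0 => hd0 ((hG.order.eq_zero_iff hd).2 h0)
      have hψd := hG.psi_mem d hd hd0
      have hdg1 : d.2 + ψ₁ d.2 = g.2 := (hG.order.eq_iff (G.add_mem hd hψd) hg).1 hdg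
      obtain ⟨e, he, he0, hde⟩ := hG.exists_psi_gt h h₁ hψd (h.cut.psi_mem hd0)
      have he1 := (hG.order e he).1 he0
      have hde1 : ψ₁ d.2 < ψ₁ e.2 := (hG.order.lt_iff hψd (hG.psi_mem e he he0.ne')).1 hde
      have hxe := hgap e he he0.ne'
      have hye := hylt e he he0.ne'
      rw [abs_of_pos he0] at hxe
      rw [abs_of_pos he1] at hye
      rw [← hdg, ← hdg1, h.couple.psi_sub_add_psi hd0 he0 hde hxe.1 hxe.2,
        h₁.couple.psi_sub_add_psi hd1 he1 hde1 hye.1 hye.2]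
      rcases hd0.lt_or_gt with hneg | hpos
      · have hneg1 := (hG.order.lt_zero_iff hd).1 hneg
        have h3 : 0 < x - (d.1 + ψ d.1) := sub_pos.2
          ((add_lt_of_neg_left _ hneg).trans (hgap d hd hd0).1)
        have h4 : 0 < y - (d.2 + ψ₁ d.2) := sub_pos.2
          ((add_lt_of_neg_left _ hneg1).trans (hylt d hd hd0).1)
        exact ⟨h3.ne', h4.ne', iff_of_true h3 h4, mem_valueSet hd hd0⟩
      · have hpos1 := (hG.order d hd).1 hpos
        have h3 := (hgap d hd hd0).2
        have h4 := (hylt d hd hd0).2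
        rw [abs_of_pos hpos, ← sub_neg] at h3
        rw [abs_of_pos hpos1, ← sub_neg] at h4
        exact ⟨h3.ne, h4.ne, iff_of_false h3.not_gt h4.not_gt, mem_valueSet hd hd0⟩)
  set G' := G ⊔ Submodule.span k {(x, y)} with hG'
  have hle : G ≤ G' := le_sup_left
  have hxy : (x, y) ∈ G' := Submodule.mem_sup_right (Submodule.mem_span_singleton_self _)
  have hψ : ∀ p ∈ G', p.1 ≠ 0 → (ψ p.1, ψ₁ p.2) ∈ G' := by
    intro p hp hp0
    obtain ⟨q, hq, hq0, h2⟩ := hval p hp hp0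
    rw [← h2]
    exact hle (hG.psi_mem q hq hq0)
  have hiso : IsIsoGraph ψ P ψ₁ P₁ G' := by
    refine ⟨hord, hψ, fun p hp => ?_⟩
    by_cases hb : ∃ e ∈ G, e.1 ≠ 0 ∧ (p.1 ≤ ψ e.1 ∨ |e.1| + ψ e.1 ≤ p.1)
    · obtain ⟨e, he, heb⟩ := hb
      exact hord.cut_iff_of_bound hψ h.toIsHTriple h₁.toIsHTriple hp ⟨e, hle he, heb⟩
    push Not at hb
    -- Two elements of the gap differ by at most `|e.1|` for every positive `e.1` in the old domain,
    -- so a nonzero difference would have value above all old values; but `G'` has only old values.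
    have hpx : p.1 = x := by
      by_contra hne
      obtain ⟨q, hq, hq0, h2⟩ := hval _ (G'.sub_mem hp hxy) (sub_ne_zero.2 hne)
      obtain ⟨e, he, he0, hqe⟩ := hG.exists_psi_gt h h₁ (hG.psi_mem q hq hq0) (h.cut.psi_mem hq0)
      have h3 := hgap e he he0.ne'
      have h4 := hb e he he0.ne'
      have h5 : |p.1 - x| ≤ |e.1| := by
        rw [abs_sub_le_iff, sub_le_iff_le_add, sub_le_iff_le_add]
        exact ⟨h4.2.le.trans (by gcongr; exact h3.1.le), h3.2.le.trans (by gcongr; exact h4.1.le)⟩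
      have h6 := h.couple.psi_le_of_abs_le (sub_ne_zero.2 hne) h5
      have h7 : ψ q.1 = ψ (p.1 - x) := (Prod.ext_iff.1 h2).1
      rw [← h7] at h6
      exact h6.not_gt hqe
    rw [hpx, (hord.eq_iff hp hxy).1 hpx, hyP]
  -- By maximality `x` is in the domain, hence is the derivative of some `d.1` there; but no such
  -- derivative lies in the gap, whatever the sign of `d.1`.
  obtain ⟨d, hd, hd0, hdx⟩ := hG.exists_add_psi_eq h h₁ (hG.mem_of_isIsoGraph hiso)
  dsimp only at hdx
  rcases hd0.lt_or_gt with hneg | hpos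
  · have := (hgap d hd hd0).1
    rw [← hdx] at this
    exact this.not_gt (add_lt_of_neg_left _ hneg)
  · have := (hgap d hd hd0).2
    rw [← hdx, abs_of_pos hpos] at this
    exact lt_irrefl _ this

/-- Elements outside the domain have distances whose `ψ`-values lie outside the domain. -/
theorem exists_psi_sub_notMem [Countable M] (hG : IsMaximalIsoGraph ψ P ψ₁ P₁ G)
    (h : IsClosedHTriple k ψ P) (h₁ : IsClosedHTriple k ψ₁ P₁) (hsat : IsSaturated ψ₁ P₁) {x : M}
    (hx : x ∉ G.map (LinearMap.fst k M N)) :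
    ∃ g ∈ G, ψ (x - g.1) ∉ G.map (LinearMap.fst k M N) := by
  classical
  by_contra! hc
  have := hG.order.countable
  have hxg : ∀ g ∈ G, x - g.1 ≠ 0 := fun g hg h0 => hx ⟨g, hg, (sub_eq_zero.1 h0).symm⟩
  have hc' : ∀ g : G, ∃ v ∈ G, v.1 = ψ (x - g.1.1) := fun g => hc g.1 g.2
  -- The second coordinate of `v g` prescribes the value that `y - g.2` must have in `N`.
  choose v hvG hv using hc'
  obtain ⟨y, hy⟩ := hsat.exists_of_countable (ι := G)
    (C := fun g => {z | z ≠ g.1.2} ∩ {z | z ∈ {z | 0 < z - g.1.2} ↔ 0 < x - g.1.1} ∩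
      {z | ψ₁ (z - g.1.2) = (v g).2})
    (fun g => ((IsDefSet.ne .id (.const _)).inter
      ((IsDefSet.pos (IsDefMap.sub .id (.const _))).iff_prop _)).inter
        (IsDefSet.eq (IsDefMap.sub .id (.const _)).psi (.const _))) (by
      intro s
      obtain ⟨w, ⟨p, hp, rfl⟩, hws⟩ := h.couple.exists_approx hx (by
        rintro _ ⟨g, hg, rfl⟩
        obtain ⟨d, hd, hd0, hdψ⟩ := hG.exists_psi_eq h h₁ (hvG ⟨g, hg⟩)
          (by rw [hv]; exact h.cut.psi_mem (hxg g hg))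
        exact ⟨d.1, ⟨d, hd, rfl⟩, hd0, by rw [hdψ, hv]; rfl⟩)
        (s.image fun g => g.1.1) (by
          intro a ha
          obtain ⟨g, -, rfl⟩ := Finset.mem_image.1 ha
          exact ⟨g.1, g.2, rfl⟩)
      refine ⟨p.2, fun g hg => ?_⟩
      obtain ⟨n1, n2, n3⟩ := hws _ (Finset.mem_image_of_mem _ hg)
      have hd := G.sub_mem hp g.2
      refine ⟨⟨fun h0 => n1 ((hG.order.eq_iff hp g.2).2 h0), ?_⟩, ?_⟩
      · exact (hG.order _ hd).symm.trans n2
      · exact (hG.order.eq_iff (hG.psi_mem _ hd (sub_ne_zero.2 n1)) (hvG g)).1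
          (n3.trans (hv g).symm))
  obtain ⟨hord, hval⟩ := isOrderGraph_sup_span_of_translates (V := G) h.couple h₁.couple hG.order
    hG.psi_mem (x := x) (y := y) (by
      intro g hg
      obtain ⟨⟨n1, n2⟩, n3⟩ := hy ⟨g, hg⟩
      refine ⟨hxg g hg, sub_ne_zero.2 n1, n2.symm, ?_⟩
      have := hvG ⟨g, hg⟩
      rwa [show v ⟨g, hg⟩ = (ψ (x - g.1), ψ₁ (y - g.2)) from
        Prod.ext (hv ⟨g, hg⟩) (Eq.symm n3)] at this)
  have hψ : ∀ p ∈ G ⊔ Submodule.span k {(x, y)}, p.1 ≠ 0 →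
      (ψ p.1, ψ₁ p.2) ∈ G ⊔ Submodule.span k {(x, y)} :=
    fun p hp hp0 => Submodule.mem_sup_left (hval p hp hp0)
  refine hx ⟨_, hG.mem_of_isIsoGraph ⟨hord, hψ, fun p hp => ?_⟩, rfl⟩
  obtain ⟨e, he, heb⟩ := hG.exists_bound h h₁ hsat p.1
  exact hord.cut_iff_of_bound hψ h.toIsHTriple h₁.toIsHTriple hp
    ⟨e, Submodule.mem_sup_left he, heb⟩

/-- `ψ z` is not in a gap, and (AC3) keeps it below every derivative of a positive element; so it is
bounded by a value on the domain, and that value is not the largest. -/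
theorem exists_psi_lt [Countable M] (hG : IsMaximalIsoGraph ψ P ψ₁ P₁ G)
    (h : IsClosedHTriple k ψ P) (h₁ : IsClosedHTriple k ψ₁ P₁) (hsat : IsSaturated ψ₁ P₁) {z : M}
    (hz : z ≠ 0) : ∃ e ∈ G, e.1 ≠ 0 ∧ ψ z < ψ e.1 := by
  obtain ⟨e, he, he0, hze | hze⟩ := hG.exists_bound h h₁ hsat (ψ z)
  · obtain ⟨f, hf, hf0, hef⟩ := hG.exists_psi_gt h h₁ (hG.psi_mem e he he0) (h.cut.psi_mem he0)
    exact ⟨f, hf, hf0.ne', hze.trans_lt hef⟩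
  · have := h.couple.ac3 |e.1| z hz (abs_pos.2 he0)
    rw [h.couple.psi_abs he0] at this
    exact absurd this hze.not_gt

/-- A maximal partial isomorphism transfers infinite chains into a saturated H-triple. -/
theorem exists_chain [Countable M] (hG : IsMaximalIsoGraph ψ P ψ₁ P₁ G)
    (h : IsClosedHTriple k ψ P) (h₁ : IsClosedHTriple k ψ₁ P₁) (hsat : IsSaturated ψ₁ P₁)
    (y : ℕ → M) (a : ℕ → M × N) (ha : ∀ i, a i ∈ G) (hya : ∀ i, y (i + 1) = ψ (y i) - (a i).1)
    (hy : ∀ i, y i ≠ 0) (hyA : ∀ i, ψ (y i) ∉ G.map (LinearMap.fst k M N)) :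
    ∃ z : ℕ → N, (∀ i, z (i + 1) = ψ₁ (z i) - (a i).2) ∧ (∀ i, z i ≠ 0) ∧
      (∀ i, 0 < y i ↔ 0 < z i) ∧
      ∀ i, ∀ g ∈ G, g.2 ≠ ψ₁ (z i) ∧ (g.1 < ψ (y i) ↔ g.2 < ψ₁ (z i)) := by
  classical
  have := hG.order.countable
  have hcd := fun i => isDefMap_chain (ψ := ψ₁) (fun j => (a j).2) i
  obtain ⟨z, hz⟩ := hsat.exists_of_countable (ι := ℕ × G)
    (C := fun q => {z | chain ψ₁ (fun j => (a j).2) q.1 z ≠ 0} ∩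
      {z | z ∈ {z | 0 < chain ψ₁ (fun j => (a j).2) q.1 z} ↔ 0 < y q.1} ∩
      ({z | q.2.1.2 ≠ ψ₁ (chain ψ₁ (fun j => (a j).2) q.1 z)} ∩
      {z | z ∈ {z | q.2.1.2 < ψ₁ (chain ψ₁ (fun j => (a j).2) q.1 z)} ↔ q.2.1.1 < ψ (y q.1)}))
    (fun q => ((IsDefSet.ne (hcd _) (.const _)).inter ((IsDefSet.pos (hcd _)).iff_prop _)).inter
      ((IsDefSet.ne (.const _) (hcd _).psi).inter
        ((IsDefSet.lt (.const _) (hcd _).psi).iff_prop _))) (by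
      intro s
      obtain ⟨w, ⟨p, hp, rfl⟩, hws⟩ := h.toIsHTriple.exists_chain_approx
        (A := G.map (LinearMap.fst k M N)) (fun a ha h0 => hG.fst_psi_mem ha h0) (by
          rintro _ ⟨b, hb, rfl⟩ hbP
          obtain ⟨d, hd, hd0, hdb⟩ := hG.exists_psi_eq h h₁ hb hbP
          exact ⟨d.1, ⟨d, hd, rfl⟩, hd0, hdb⟩) (by
          intro x hx
          obtain ⟨e, he, he0, hxe⟩ := hG.exists_psi_lt h h₁ hsat hx
          exact ⟨e.1, ⟨e, he, rfl⟩, he0, hxe⟩)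
        (s.sup fun q => q.1) y (fun i => (a i).1) (fun i => ⟨a i, ha i, rfl⟩) hya hy hyA
        (s.image fun q => q.2.1.1) (by
          intro b hb
          obtain ⟨q, -, rfl⟩ := Finset.mem_image.1 hb
          exact ⟨q.2.1, q.2.2, rfl⟩)
      -- The approximant and its image under `G` have chains corresponding term by term, so finite
      -- satisfiability passes from `M` to `N`.
      have htr : ∀ i ≤ s.sup fun q => q.1, (chain ψ (fun j => (a j).1) i p.1,
          chain ψ₁ (fun j => (a j).2) i p.2) ∈ G := by
        intro i
        induction i with
        | zero => exact fun _ => hp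
        | succ i ih =>
          intro hi
          have hi' := (Nat.le_succ i).trans hi
          exact G.sub_mem (hG.psi_mem _ (ih hi') (hws i hi').1) (ha i)
      refine ⟨p.2, fun q hq => ?_⟩
      have hi : q.1 ≤ s.sup fun q => q.1 := Finset.le_sup (f := fun q : ℕ × G => q.1) hq
      obtain ⟨n1, n2, n3⟩ := hws q.1 hi
      obtain ⟨n4, n5⟩ := n3 _ (Finset.mem_image_of_mem _ hq)
      have h2 := htr q.1 hi
      have h3 := hG.psi_mem _ h2 n1
      refine ⟨⟨fun h0 => n1 ((hG.order.eq_zero_iff h2).2 h0), (hG.order _ h2).symm.trans n2⟩,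
        fun h0 => n4 ((hG.order.eq_iff q.2.2 h3).2 h0), ?_⟩
      exact (hG.order.lt_iff q.2.2 h3).symm.trans n5)
  refine ⟨fun i => chain ψ₁ (fun j => (a j).2) i z, fun i => rfl, fun i => ?_, fun i => ?_,
    fun i g hg => ?_⟩
  · exact (hz (i, 0)).1.1
  · exact (hz (i, 0)).1.2.symm
  · exact ⟨(hz (i, ⟨g, hg⟩)).2.1, (hz (i, ⟨g, hg⟩)).2.2.symm⟩

/-- A maximal partial isomorphism from a countable closed H-triple into a saturated one is total. -/
theorem map_fst_eq_top [Countable M] (hG : IsMaximalIsoGraph ψ P ψ₁ P₁ G)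
    (h : IsClosedHTriple k ψ P) (h₁ : IsClosedHTriple k ψ₁ P₁) (hsat : IsSaturated ψ₁ P₁) :
    G.map (LinearMap.fst k M N) = ⊤ := by
  set A := G.map (LinearMap.fst k M N) with hA
  by_contra hne
  obtain ⟨x₀, -, hx₀⟩ := SetLike.exists_of_lt (lt_top_iff_ne_top.2 hne)
  have hstep : ∀ x : {x // x ∉ A}, ∃ g ∈ G, ψ (x.1 - g.1) ∉ A := fun x =>
    hG.exists_psi_sub_notMem h h₁ hsat x.2
  choose g hgG hg using hstep
  -- Each `x (n + 1)` is the value `ψ (y n)`, again outside `A`; so `y (n + 1)` is `ψ (y n)` minus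
  -- an element of `A`.
  let x : ℕ → {x // x ∉ A} := fun n => Nat.rec ⟨x₀, hx₀⟩ (fun _ t => ⟨ψ (t.1 - (g t).1), hg t⟩) n
  let y : ℕ → M := fun n => (x n).1 - (g (x n)).1
  let a : ℕ → M × N := fun n => g (x (n + 1))
  have ha : ∀ i, a i ∈ G := fun i => hgG _
  have hya : ∀ i, y (i + 1) = ψ (y i) - (a i).1 := fun i => rfl
  have hyA' : ∀ i, y i ∉ A := fun i hi => (x i).2 (by
    have : (x i).1 = y i + (g (x i)).1 := (sub_add_cancel _ _).symm
    rw [this]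
    exact A.add_mem hi ⟨_, hgG _, rfl⟩)
  have hy : ∀ i, y i ≠ 0 := fun i h0 => hyA' i (h0 ▸ A.zero_mem)
  have hyA : ∀ i, ψ (y i) ∉ A := fun i => (x (i + 1)).2
  obtain ⟨z, hza, hz, hyz, hcut⟩ := hG.exists_chain h h₁ hsat y a ha hya hy hyA
  have hψne : ∀ i, ∀ g ∈ G, g.1 ≠ ψ (y i) := fun i g hg h0 => hyA i ⟨g, hg, h0⟩
  have hmono : StrictMono fun i => ψ (y i) := strictMono_nat_of_lt_succ fun i => by
    obtain ⟨e, he, he0, hlt⟩ := hG.exists_psi_lt h h₁ hsat (hy i)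
    have hψe := hG.psi_mem e he he0
    rw [hya i]
    refine h.couple.psi_lt_psi_psi_sub (hy i) he0 hlt (hψne i _ (ha i)).symm fun h2 h3 => ?_
    rw [← hya i] at h3
    exact hψne (i + 1) _ (hG.psi_mem _ (G.sub_mem (ha i) hψe) (sub_ne_zero.2 h2)) h3.symm
  have hmono₁ : StrictMono fun i => ψ₁ (z i) := strictMono_nat_of_lt_succ fun i => by
    obtain ⟨e, he, he0, hlt⟩ := hG.exists_psi_lt h h₁ hsat (hy i)
    have hψe := hG.psi_mem e he he0
    have he1 : e.2 ≠ 0 := fun h0 => he0 ((hG.order.eq_zero_iff he).2 h0)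
    have hlt1 : ψ₁ (z i) < ψ₁ e.2 := lt_of_le_of_ne
      (not_lt.1 fun h2 => ((hcut i _ hψe).2.2 h2).not_gt hlt) (hcut i _ hψe).1.symm
    rw [hza i]
    refine h₁.couple.psi_lt_psi_psi_sub (hz i) he1 hlt1 (hcut i _ (ha i)).1.symm fun h2 h3 => ?_
    rw [← hza i] at h3
    exact (hcut (i + 1) _ (hG.psi_mem _ (G.sub_mem (ha i) hψe)
      (sub_ne_zero.2 fun h4 => h2 ((hG.order.eq_iff (ha i) hψe).1 h4)))).1 h3.symm
  -- Closure under `ψ` is reached only in the limit: `ψ (y i) = y (i + 1) + (a i).1` involves the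
  -- next pair. Strict monotonicity of the values makes each single step order preserving.
  let H : ℕ → Submodule k (M × N) := fun n =>
    Nat.rec G (fun i K => K ⊔ Submodule.span k {(y i, z i)}) n
  have hHsucc : ∀ n, H (n + 1) = H n ⊔ Submodule.span k {(y n, z n)} := fun n => rfl
  have hHmono : Monotone H := monotone_nat_of_le_succ fun n => (hHsucc n).symm ▸ le_sup_left
  have hH : ∀ n, IsOrderGraph (H n) ∧ ∀ p ∈ H n, p.1 ≠ 0 →
      (ψ p.1, ψ₁ p.2) ∈ valueSet ψ ψ₁ G ∪ {v | ∃ i < n, (ψ (y i), ψ₁ (z i)) = v} := by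
    intro n
    induction n with
    | zero => exact ⟨hG.order, fun p hp hp0 => Or.inl ⟨p, hp, hp0, rfl⟩⟩
    | succ n ih =>
      obtain ⟨h2, h3⟩ := isOrderGraph_sup_span h.couple h₁.couple ih.1 ih.2 (hy n) (hz n) (hyz n) (by
        rintro v (⟨p, hp, hp0, rfl⟩ | ⟨i, hi, rfl⟩)
        · have := hG.psi_mem p hp hp0
          exact ⟨hψne n _ this, hcut n _ this⟩
        · exact ⟨(hmono hi).ne, (hmono₁ hi).ne, iff_of_true (hmono hi) (hmono₁ hi)⟩)
      refine ⟨h2, fun p hp hp0 => ?_⟩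
      rcases h3 p hp hp0 with h4 | h4 | ⟨i, hi, h4⟩
      · exact Or.inr ⟨n, n.lt_succ_self, h4.symm⟩
      · exact Or.inl h4
      · exact Or.inr ⟨i, hi.trans n.lt_succ_self, h4⟩
  have hmem : ∀ p, p ∈ ⨆ n, H n ↔ ∃ n, p ∈ H n := fun p =>
    Submodule.mem_iSup_of_directed _ hHmono.directed_le
  have hle : G ≤ ⨆ n, H n := le_iSup H 0
  have hyz' : ∀ i, (y i, z i) ∈ ⨆ n, H n := fun i => (hmem _).2
    ⟨i + 1, Submodule.mem_sup_right (Submodule.mem_span_singleton_self _)⟩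
  have hord : IsOrderGraph (⨆ n, H n) := fun p hp => by
    obtain ⟨n, hn⟩ := (hmem p).1 hp
    exact (hH n).1 p hn
  have hψ : ∀ p ∈ ⨆ n, H n, p.1 ≠ 0 → (ψ p.1, ψ₁ p.2) ∈ ⨆ n, H n := by
    intro p hp hp0
    obtain ⟨n, hn⟩ := (hmem p).1 hp
    rcases (hH n).2 p hn hp0 with ⟨q, hq, hq0, h2⟩ | ⟨i, -, h2⟩
    · rw [← h2]
      exact hle (hG.psi_mem q hq hq0)
    · rw [← h2]
      have := Submodule.add_mem _ (hyz' (i + 1)) (hle (ha i))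
      rwa [hya, hza, show (ψ (y i) - (a i).1, ψ₁ (z i) - (a i).2) + a i = (ψ (y i), ψ₁ (z i)) from
        Prod.ext (sub_add_cancel _ _) (sub_add_cancel _ _)] at this
  refine hyA' 0 ⟨_, hG.maximal _ ⟨hord, hψ, fun p hp => ?_⟩ hle (hyz' 0), rfl⟩
  obtain ⟨e, he, heb⟩ := hG.exists_bound h h₁ hsat p.1
  exact hord.cut_iff_of_bound hψ h.toIsHTriple h₁.toIsHTriple hp ⟨e, hle he, heb⟩

end IsMaximalIsoGraph

/-- Every partial isomorphism extends to a maximal one. -/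
theorem IsIsoGraph.exists_maximal (hG : IsIsoGraph ψ P ψ₁ P₁ G) :
    ∃ G', G ≤ G' ∧ IsMaximalIsoGraph ψ P ψ₁ P₁ G' := by
  obtain ⟨G', hle, hmax⟩ := zorn_le_nonempty₀ {G : Submodule k (M × N) | IsIsoGraph ψ P ψ₁ P₁ G}
    (fun c hc hchain K hK => by
      have hmem : ∀ p, p ∈ sSup c ↔ ∃ H ∈ c, p ∈ H := fun p =>
        Submodule.mem_sSup_of_directed ⟨K, hK⟩ hchain.directedOn
      refine ⟨sSup c, ⟨fun p hp => ?_, fun p hp hp0 => ?_, fun p hp => ?_⟩, fun _ => le_sSup⟩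
      · obtain ⟨H, hH, hpH⟩ := (hmem p).1 hp
        exact (hc hH).order p hpH
      · obtain ⟨H, hH, hpH⟩ := (hmem p).1 hp
        exact (hmem _).2 ⟨H, hH, (hc hH).psi_mem p hpH hp0⟩
      · obtain ⟨H, hH, hpH⟩ := (hmem p).1 hp
        exact (hc hH).cut_iff p hpH) G hG
  exact ⟨G', hle, hmax.prop, fun K hK hGK => hmax.2 hK hGK⟩

/-- Partial isomorphisms from a countable closed H-triple into a countably saturated closed
H-triple extend to embeddings. -/
theorem IsIsoGraph.exists_total [Countable M] (hG : IsIsoGraph ψ P ψ₁ P₁ G)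
    (h : IsClosedHTriple k ψ P) (h₁ : IsClosedHTriple k ψ₁ P₁) (hsat : IsSaturated ψ₁ P₁) :
    ∃ G', G ≤ G' ∧ IsIsoGraph ψ P ψ₁ P₁ G' ∧ ∀ x, ∃ y, (x, y) ∈ G' := by
  obtain ⟨G', hle, hmax⟩ := hG.exists_maximal
  refine ⟨G', hle, hmax.toIsIsoGraph, fun x => ?_⟩
  have : x ∈ G'.map (LinearMap.fst k M N) := by
    rw [hmax.map_fst_eq_top h h₁ hsat]
    trivial
  obtain ⟨p, hp, rfl⟩ := this
  exact ⟨p.2, hp⟩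

end Extension

/-! ### Countable closed substructures -/

section Countable

variable {k : Type*} [Field k] [LinearOrder k] [IsStrictOrderedRing k]
  {M : Type*} [AddCommGroup M] [LinearOrder M] [IsOrderedAddMonoid M]
  [Module k M] [PosSMulStrictMono k M]

instance (K : Submodule k M) : PosSMulStrictMono k K where
  smul_lt_smul_of_pos_left _ hc _ _ hxy := smul_lt_smul_of_pos_left (α := k) (β := M) hxy hc

/-- A countable set lies in a countable subspace closed under countably many given maps. -/
theorem exists_countable_submodule [Countable k] (f : ℕ → M → M) {S : Set M} (hS : S.Countable) :
    ∃ K : Submodule k M, Countable K ∧ S ⊆ K ∧ ∀ i, ∀ x ∈ K, f i x ∈ K := by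
  let step : Set M → Set M := fun T => T ∪ Set.image2 (· + ·) T T ∪
    Set.image2 (fun (c : k) x => c • x) Set.univ T ∪ ⋃ i, f i '' T
  have hstep : ∀ T, T ⊆ step T := fun T x hx => Or.inl (Or.inl (Or.inl hx))
  let T : ℕ → Set M := fun n => Nat.rec (insert 0 S) (fun _ T => step T) n
  have hmono : Monotone T := monotone_nat_of_le_succ fun n => hstep (T n)
  have hT : ∀ n, (T n).Countable := by
    intro n
    induction n with
    | zero => exact hS.insert 0
    | succ n ih =>
      exact ((ih.union (ih.image2 ih _)).union (Set.countable_univ.image2 ih _)).union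
        (Set.countable_iUnion fun i => ih.image _)
  refine ⟨⟨⟨⟨⋃ n, T n, ?_⟩, ?_⟩, ?_⟩, ?_, ?_, ?_⟩
  · intro a b ha hb
    obtain ⟨m, hm⟩ := Set.mem_iUnion.1 ha
    obtain ⟨n, hn⟩ := Set.mem_iUnion.1 hb
    refine Set.mem_iUnion.2 ⟨max m n + 1, Or.inl (Or.inl (Or.inr ?_))⟩
    exact ⟨a, hmono (le_max_left m n) hm, b, hmono (le_max_right m n) hn, rfl⟩
  · exact Set.mem_iUnion.2 ⟨0, Set.mem_insert 0 S⟩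
  · intro c x hx
    obtain ⟨m, hm⟩ := Set.mem_iUnion.1 hx
    exact Set.mem_iUnion.2 ⟨m + 1, Or.inl (Or.inr ⟨c, trivial, x, hm, rfl⟩)⟩
  · exact (Set.countable_iUnion hT).to_subtype
  · exact fun x hx => Set.mem_iUnion.2 ⟨0, Set.mem_insert_of_mem 0 hx⟩
  · intro i x hx
    obtain ⟨m, hm⟩ := Set.mem_iUnion.1 hx
    exact Set.mem_iUnion.2 ⟨m + 1, Or.inr (Set.mem_iUnion.2 ⟨i, x, hm, rfl⟩)⟩

/-- Every countable set is contained in a countable closed sub-H-triple. -/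
theorem IsClosedHTriple.exists_countable [Countable k] {ψ : M → M} {P : Set M}
    (h : IsClosedHTriple k ψ P) {S : Set M} (hS : S.Countable) :
    ∃ (K : Submodule k M) (ψ' : K → K), Countable K ∧ S ⊆ K ∧ (∀ x : K, (ψ' x : M) = ψ x) ∧
      IsClosedHTriple k ψ' {x : K | (x : M) ∈ P} := by
  classical
  -- `I` and `J` are Skolem functions for integration and `ψ`-preimages; a subspace closed under
  -- them and `ψ` is again closed. The value `0` of `J` outside `PsiSet ψ` plays no role.
  choose I hI0 hI using h.closed.asymptoticIntegration
  let J : M → M := fun b => if hb : b ∈ PsiSet ψ then hb.choose else 0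
  have hJ : ∀ b ∈ PsiSet ψ, J b ≠ 0 ∧ ψ (J b) = b := fun b hb => by
    simp only [J, dif_pos hb]
    exact hb.choose_spec
  obtain ⟨K, hK, hSK, hKf⟩ := exists_countable_submodule (k := k)
    (fun i : ℕ => if i = 0 then ψ else if i = 1 then I else J) hS
  have hKψ : ∀ x ∈ K, ψ x ∈ K := by simpa using hKf 0
  have hKI : ∀ x ∈ K, I x ∈ K := by simpa using hKf 1
  have hKJ : ∀ x ∈ K, J x ∈ K := by simpa using hKf 2
  have hne : ∀ {x : K}, x ≠ 0 → (x : M) ≠ 0 := fun hx h0 => hx (Subtype.ext h0)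
  refine ⟨K, fun x => ⟨ψ x, hKψ x x.2⟩, hK, hSK, fun _ => rfl, ?_⟩
  have hlower : IsLowerSet {x : K | (x : M) ∈ P} := fun x y hyx hx =>
    h.cut.isLowerSet (show (y : M) ≤ x from hyx) hx
  refine ⟨⟨⟨⟨fun a b ha hb hab => ?_, fun m a hm ha => ?_, fun a b hb ha => ?_,
    fun a b ha hab => ?_⟩, fun c a hc ha => ?_⟩, hlower, ?_, fun p hp a ha => ?_⟩,
    fun n hn a => ?_, fun a b hba ha => ?_, fun b => ?_⟩
  · exact h.couple.ac1 a b (hne ha) (hne hb) (hne hab)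
  · exact Subtype.ext (h.couple.ac2 m a hm (hne ha))
  · exact h.couple.ac3 a b (hne hb) ha
  · exact h.couple.hc a b ha hab
  · exact Subtype.ext (h.couple.psi_smul c a hc (hne ha))
  · rintro _ ⟨a, ha, rfl⟩
    exact h.cut.psi_mem (hne ha)
  · exact h.cut.lt_deriv p hp a ha
  · refine ⟨(n : k)⁻¹ • a, ?_⟩
    rw [← Nat.cast_smul_eq_nsmul k, smul_smul, mul_inv_cancel₀ (Nat.cast_ne_zero.2 hn), one_smul]
  · obtain ⟨c, hc, rfl⟩ := ha
    have hb : (b : M) ∈ PsiSet ψ := h.closed.isLowerSet_psiSet hba ⟨c, hne hc, rfl⟩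
    refine ⟨⟨J b, hKJ b b.2⟩, fun h0 => (hJ b hb).1 (Subtype.ext_iff.1 h0), ?_⟩
    exact Subtype.ext (hJ b hb).2
  · exact ⟨⟨I b, hKI b b.2⟩, fun h0 => hI0 b (Subtype.ext_iff.1 h0), Subtype.ext (hI b)⟩

end Countable

/-! ### Ultraproducts of H-triples -/

section Ultraproduct

open Filter

variable (k : Type*) [Field k] [LinearOrder k] [IsStrictOrderedRing k]
  (Γ : ℕ → Type*) [∀ n, AddCommGroup (Γ n)] [∀ n, LinearOrder (Γ n)]
  [∀ n, IsOrderedAddMonoid (Γ n)] [∀ n, Module k (Γ n)] [∀ n, PosSMulStrictMono k (Γ n)]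
  (U : Ultrafilter ℕ)

/-- The sequences vanishing `U`-almost everywhere. -/
def nullSubmodule : Submodule k (∀ n, Γ n) where
  carrier := {f | ∀ᶠ n in U, f n = 0}
  add_mem' {f g} hf hg := by
    filter_upwards [hf, hg] with n h1 h2
    simp [h1, h2]
  zero_mem' := Eventually.of_forall fun _ => rfl
  smul_mem' c f hf := by
    filter_upwards [hf] with n h1
    simp [h1]

/-- The ultraproduct of a sequence of vector spaces over `k`. -/
def Ultraproduct : Type _ := (∀ n, Γ n) ⧸ nullSubmodule k Γ U

namespace Ultraproduct

instance : AddCommGroup (Ultraproduct k Γ U) :=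
  inferInstanceAs (AddCommGroup ((∀ n, Γ n) ⧸ nullSubmodule k Γ U))

instance : Module k (Ultraproduct k Γ U) :=
  inferInstanceAs (Module k ((∀ n, Γ n) ⧸ nullSubmodule k Γ U))

/-- The class of a sequence in the ultraproduct. -/
def mk : (∀ n, Γ n) →ₗ[k] Ultraproduct k Γ U := (nullSubmodule k Γ U).mkQ

variable {k Γ U}

theorem mk_surjective : Function.Surjective (mk k Γ U) := Submodule.mkQ_surjective _

theorem mk_eq_mk {f g : ∀ n, Γ n} : mk k Γ U f = mk k Γ U g ↔ ∀ᶠ n in U, f n = g n := by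
  refine ((nullSubmodule k Γ U).quotientRel_def.symm.trans Quotient.eq.symm).symm.trans ?_
  exact eventually_congr (Eventually.of_forall fun n => sub_eq_zero)

instance : LE (Ultraproduct k Γ U) :=
  ⟨fun x y => ∃ f g, mk k Γ U f = x ∧ mk k Γ U g = y ∧ ∀ᶠ n in U, f n ≤ g n⟩

theorem mk_le_mk {f g : ∀ n, Γ n} : mk k Γ U f ≤ mk k Γ U g ↔ ∀ᶠ n in U, f n ≤ g n := by
  refine ⟨?_, fun h => ⟨f, g, rfl, rfl, h⟩⟩
  rintro ⟨f', g', hf, hg, h⟩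
  filter_upwards [mk_eq_mk.1 hf, mk_eq_mk.1 hg, h] with n h1 h2 h3
  rwa [← h1, ← h2]

noncomputable instance : LinearOrder (Ultraproduct k Γ U) where
  le_refl x := by
    obtain ⟨f, rfl⟩ := mk_surjective x
    exact mk_le_mk.2 (Eventually.of_forall fun n => le_rfl)
  le_trans x y z := by
    obtain ⟨f, rfl⟩ := mk_surjective x
    obtain ⟨g, rfl⟩ := mk_surjective y
    obtain ⟨h, rfl⟩ := mk_surjective z
    simp only [mk_le_mk]
    intro h1 h2
    filter_upwards [h1, h2] with n using le_trans
  le_antisymm x y := by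
    obtain ⟨f, rfl⟩ := mk_surjective x
    obtain ⟨g, rfl⟩ := mk_surjective y
    simp only [mk_le_mk, mk_eq_mk]
    intro h1 h2
    filter_upwards [h1, h2] with n using le_antisymm
  le_total x y := by
    obtain ⟨f, rfl⟩ := mk_surjective x
    obtain ⟨g, rfl⟩ := mk_surjective y
    simp only [mk_le_mk]
    exact Ultrafilter.eventually_or.1 (Eventually.of_forall fun n => le_total _ _)
  toDecidableLE := Classical.decRel _

theorem mk_lt_mk {f g : ∀ n, Γ n} : mk k Γ U f < mk k Γ U g ↔ ∀ᶠ n in U, f n < g n := by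
  simp only [← not_le, mk_le_mk, Ultrafilter.eventually_not]

theorem mk_ne_zero {f : ∀ n, Γ n} : mk k Γ U f ≠ 0 ↔ ∀ᶠ n in U, f n ≠ 0 := by
  rw [← map_zero (mk k Γ U), Ne, mk_eq_mk, ← Ultrafilter.eventually_not]
  rfl

theorem mk_pos {f : ∀ n, Γ n} : 0 < mk k Γ U f ↔ ∀ᶠ n in U, 0 < f n := by
  rw [← map_zero (mk k Γ U), mk_lt_mk]
  rfl

instance : IsOrderedAddMonoid (Ultraproduct k Γ U) where
  add_le_add_left x y hxy z := by
    obtain ⟨f, rfl⟩ := mk_surjective x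
    obtain ⟨g, rfl⟩ := mk_surjective y
    obtain ⟨h, rfl⟩ := mk_surjective z
    rw [← map_add, ← map_add, mk_le_mk]
    filter_upwards [mk_le_mk.1 hxy] with n h1
    simpa using h1

instance : PosSMulStrictMono k (Ultraproduct k Γ U) where
  smul_lt_smul_of_pos_left c hc x y hxy := by
    obtain ⟨f, rfl⟩ := mk_surjective x
    obtain ⟨g, rfl⟩ := mk_surjective y
    rw [← map_smul, ← map_smul, mk_lt_mk]
    filter_upwards [mk_lt_mk.1 hxy] with n h1
    exact smul_lt_smul_of_pos_left h1 hc

/-- The map on an ultraproduct induced by a sequence of maps. -/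
noncomputable def map (ψ : ∀ n, Γ n → Γ n) (x : Ultraproduct k Γ U) : Ultraproduct k Γ U :=
  mk k Γ U fun n => ψ n (Function.surjInv mk_surjective x n)

theorem map_mk (ψ : ∀ n, Γ n → Γ n) (f : ∀ n, Γ n) :
    map ψ (mk k Γ U f) = mk k Γ U fun n => ψ n (f n) := by
  rw [map, mk_eq_mk]
  filter_upwards [mk_eq_mk.1 (Function.surjInv_eq mk_surjective (mk k Γ U f))] with n h
  rw [h]

variable (k U) in
/-- The subset of an ultraproduct induced by a sequence of sets. -/
def cut (P : ∀ n, Set (Γ n)) : Set (Ultraproduct k Γ U) :=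
  {x | ∃ f, mk k Γ U f = x ∧ ∀ᶠ n in U, f n ∈ P n}

theorem mk_mem_cut {P : ∀ n, Set (Γ n)} {f : ∀ n, Γ n} :
    mk k Γ U f ∈ cut k U P ↔ ∀ᶠ n in U, f n ∈ P n := by
  refine ⟨?_, fun h => ⟨f, rfl, h⟩⟩
  rintro ⟨g, hg, h⟩
  filter_upwards [mk_eq_mk.1 hg, h] with n h1 h2
  rwa [← h1]

theorem isClosedHTriple {ψ : ∀ n, Γ n → Γ n} {P : ∀ n, Set (Γ n)}
    (h : ∀ n, IsClosedHTriple k (ψ n) (P n)) : IsClosedHTriple k (map ψ) (cut k U P) := by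
  refine ⟨⟨⟨⟨fun a b ha hb hab => ?_, fun m a hm ha => ?_, fun a b hb ha => ?_,
    fun a b ha hab => ?_⟩, fun c a hc ha => ?_⟩, fun a b hba ha => ?_, ?_, fun p hp a ha => ?_⟩,
    fun m hm a => ?_, fun a b hba ha => ?_, fun b => ?_⟩
  · obtain ⟨f, rfl⟩ := mk_surjective a
    obtain ⟨g, rfl⟩ := mk_surjective b
    rw [← map_add, mk_ne_zero] at hab
    rw [← map_add, map_mk, map_mk, map_mk, min_le_iff, mk_le_mk, mk_le_mk,
      ← Ultrafilter.eventually_or]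
    filter_upwards [mk_ne_zero.1 ha, mk_ne_zero.1 hb, hab] with n h1 h2 h3
    exact min_le_iff.1 ((h n).couple.ac1 _ _ h1 h2 h3)
  · obtain ⟨f, rfl⟩ := mk_surjective a
    rw [← map_zsmul, map_mk, map_mk, mk_eq_mk]
    filter_upwards [mk_ne_zero.1 ha] with n h1
    exact (h n).couple.ac2 m _ hm h1
  · obtain ⟨f, rfl⟩ := mk_surjective a
    obtain ⟨g, rfl⟩ := mk_surjective b
    rw [map_mk, map_mk, ← map_add, mk_lt_mk]
    filter_upwards [mk_ne_zero.1 hb, mk_pos.1 ha] with n h1 h2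
    exact (h n).couple.ac3 _ _ h1 h2
  · obtain ⟨f, rfl⟩ := mk_surjective a
    obtain ⟨g, rfl⟩ := mk_surjective b
    rw [map_mk, map_mk, mk_le_mk]
    filter_upwards [mk_pos.1 ha, mk_le_mk.1 hab] with n h1 h2
    exact (h n).couple.hc _ _ h1 h2
  · obtain ⟨f, rfl⟩ := mk_surjective a
    rw [← map_smul, map_mk, map_mk, mk_eq_mk]
    filter_upwards [mk_ne_zero.1 ha] with n h1
    exact (h n).couple.psi_smul c _ hc h1
  · obtain ⟨f, rfl⟩ := mk_surjective a
    obtain ⟨g, rfl⟩ := mk_surjective b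
    rw [mk_mem_cut] at ha ⊢
    filter_upwards [mk_le_mk.1 hba, ha] with n h1 h2
    exact (h n).cut.isLowerSet h1 h2
  · rintro _ ⟨a, ha, rfl⟩
    obtain ⟨f, rfl⟩ := mk_surjective a
    rw [map_mk, mk_mem_cut]
    filter_upwards [mk_ne_zero.1 ha] with n h1
    exact (h n).cut.psi_mem h1
  · obtain ⟨f, rfl⟩ := mk_surjective a
    obtain ⟨g, rfl⟩ := mk_surjective p
    rw [map_mk, ← map_add, mk_lt_mk]
    filter_upwards [mk_pos.1 ha, mk_mem_cut.1 hp] with n h1 h2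
    exact (h n).cut.lt_deriv _ h2 _ h1
  · refine ⟨(m : k)⁻¹ • a, ?_⟩
    rw [← Nat.cast_smul_eq_nsmul k, smul_smul, mul_inv_cancel₀ (Nat.cast_ne_zero.2 hm), one_smul]
  · obtain ⟨g, rfl⟩ := mk_surjective b
    obtain ⟨c, hc, rfl⟩ := ha
    obtain ⟨f, rfl⟩ := mk_surjective c
    rw [map_mk, mk_le_mk] at hba
    -- The hypotheses hold only `U`-almost everywhere, so they are put inside the statement to allow
    -- a choice at every `n`.
    have hex : ∀ n, ∃ x, g n ≤ ψ n (f n) → f n ≠ 0 → x ≠ 0 ∧ ψ n x = g n := fun n => by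
      by_cases h1 : g n ≤ ψ n (f n) ∧ f n ≠ 0
      · obtain ⟨x, hx⟩ := (h n).closed.isLowerSet_psiSet h1.1 ⟨f n, h1.2, rfl⟩
        exact ⟨x, fun _ _ => hx⟩
      · exact ⟨0, fun h2 h3 => absurd ⟨h2, h3⟩ h1⟩
    choose x hx using hex
    have hx' : ∀ᶠ n in U, x n ≠ 0 ∧ ψ n (x n) = g n := by
      filter_upwards [hba, mk_ne_zero.1 hc] with n h1 h2
      exact hx n h1 h2
    refine ⟨mk k Γ U x, mk_ne_zero.2 (hx'.mono fun n => And.left), ?_⟩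
    rw [map_mk, mk_eq_mk]
    exact hx'.mono fun n => And.right
  · obtain ⟨g, rfl⟩ := mk_surjective b
    choose x hx0 hx using fun n => (h n).closed.asymptoticIntegration (g n)
    refine ⟨mk k Γ U x, mk_ne_zero.2 (Eventually.of_forall hx0), ?_⟩
    rw [map_mk, ← map_add, mk_eq_mk]
    exact Eventually.of_forall hx

theorem exists_map_eq {ψ : ∀ n, Γ n → Γ n} {m : Ultraproduct k Γ U → Ultraproduct k Γ U}
    (hm : IsDefMap (map ψ) m) :
    ∃ F : ∀ n, Γ n → Γ n, ∀ f, m (mk k Γ U f) = mk k Γ U fun n => F n (f n) := by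
  induction hm with
  | id => exact ⟨fun n z => z, fun f => rfl⟩
  | const c =>
    obtain ⟨g, rfl⟩ := mk_surjective c
    exact ⟨fun n _ => g n, fun f => rfl⟩
  | sub _ _ ih₁ ih₂ =>
    obtain ⟨F₁, h₁⟩ := ih₁
    obtain ⟨F₂, h₂⟩ := ih₂
    exact ⟨fun n z => F₁ n z - F₂ n z, fun f => by
      dsimp only
      rw [h₁, h₂, ← map_sub]
      rfl⟩
  | psi _ ih =>
    obtain ⟨F, h⟩ := ih
    exact ⟨fun n z => ψ n (F n z), fun f => by
      dsimp only
      rw [h, map_mk]⟩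

/-- Łoś's theorem for the one-variable conditions used in saturation; parameters are replaced by
representing sequences. -/
theorem exists_mem_iff {ψ : ∀ n, Γ n → Γ n} {P : ∀ n, Set (Γ n)} {C : Set (Ultraproduct k Γ U)}
    (hC : IsDefSet (map ψ) (cut k U P) C) :
    ∃ S : ∀ n, Set (Γ n), ∀ f, mk k Γ U f ∈ C ↔ ∀ᶠ n in U, f n ∈ S n := by
  induction hC with
  | pos hm =>
    obtain ⟨F, h⟩ := exists_map_eq hm
    exact ⟨fun n => {z | 0 < F n z}, fun f => by
      rw [Set.mem_ofPred_eq, h, mk_pos]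
      rfl⟩
  | cut => exact ⟨P, fun f => mk_mem_cut⟩
  | compl _ ih =>
    obtain ⟨S, h⟩ := ih
    exact ⟨fun n => (S n)ᶜ, fun f => by
      rw [Set.mem_compl_iff, h, ← Ultrafilter.eventually_not]
      rfl⟩
  | inter _ _ ih₁ ih₂ =>
    obtain ⟨S₁, h₁⟩ := ih₁
    obtain ⟨S₂, h₂⟩ := ih₂
    exact ⟨fun n => S₁ n ∩ S₂ n, fun f => by
      rw [Set.mem_inter_iff, h₁, h₂, ← eventually_and]
      rfl⟩

/-- Ultraproducts with respect to nonprincipal ultrafilters on `ℕ` are countably saturated. -/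
theorem isSaturated (hU : (U : Filter ℕ) ≤ atTop) (ψ : ∀ n, Γ n → Γ n) (P : ∀ n, Set (Γ n)) :
    IsSaturated (map ψ : Ultraproduct k Γ U → _) (cut k U P) := by
  classical
  intro C hC hfin
  choose S hS using fun i => exists_mem_iff (hC i)
  -- At index `n`, satisfy as many initial conditions as possible, at most `n`. Condition `j` is
  -- then met at almost every index, nonprincipality removing the indices `n ≤ j`.
  let Q : ℕ → ℕ → Prop := fun n i => ∃ z, ∀ j < i, z ∈ S j n
  have hQ0 : ∀ n, Q n 0 := fun n => ⟨0, fun j hj => absurd hj (Nat.not_lt_zero j)⟩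
  have hQ : ∀ i, ∀ᶠ n in U, Q n i := by
    intro i
    obtain ⟨z, hz⟩ := hfin i
    obtain ⟨f, rfl⟩ := mk_surjective z
    have : ∀ᶠ n in U, ∀ j ∈ Finset.range i, f n ∈ S j n :=
      (Finset.eventually_all _).2 fun j hj => (hS j f).1 (hz j (Finset.mem_range.1 hj))
    exact this.mono fun n hn => ⟨f n, fun j hj => hn j (Finset.mem_range.2 hj)⟩
  have hspec : ∀ n, Q n (Nat.findGreatest (Q n) n) := fun n =>
    Nat.findGreatest_spec (Nat.zero_le n) (hQ0 n)
  choose f hf using hspec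
  refine ⟨mk k Γ U f, fun j => (hS j f).2 ?_⟩
  filter_upwards [hQ (j + 1), hU (eventually_ge_atTop (j + 1))] with n h1 h2
  exact hf n j (Nat.le_findGreatest h2 h1)

end Ultraproduct

end Ultraproduct

open FirstOrder Language

/-! ### Semantics of quantifier-free formulas -/

section Semantics

variable {k : Type*} [Field k] {α : Type*} {m : ℕ}

/-- The value of a term in an H-triple. -/
def termVal {Γ : Type*} [AddCommGroup Γ] [LinearOrder Γ] [Module k Γ] (ψ : Γ → Γ) (P : Set Γ)
    (v : α → WithTop Γ) (t : (lang k).Term α) : WithTop Γ :=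
  @Term.realize (lang k) _ (toStructure k ψ P) α v t

/-- Satisfaction of a formula in an H-triple. -/
def Sat {Γ : Type*} [AddCommGroup Γ] [LinearOrder Γ] [Module k Γ] (ψ : Γ → Γ) (P : Set Γ)
    (φ : (lang k).BoundedFormula α m) (v : α → WithTop Γ) (xs : Fin m → WithTop Γ) : Prop :=
  @BoundedFormula.Realize (lang k) _ (toStructure k ψ P) α m φ v xs

variable {Γ : Type*} [AddCommGroup Γ] [LinearOrder Γ] [Module k Γ] {ψ : Γ → Γ} {P : Set Γ}

theorem sat_equal {t₁ t₂ : (lang k).Term (α ⊕ Fin m)} {v : α → WithTop Γ}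
    {xs : Fin m → WithTop Γ} : Sat ψ P (t₁.bdEqual t₂) v xs ↔
      termVal ψ P (Sum.elim v xs) t₁ = termVal ψ P (Sum.elim v xs) t₂ := Iff.rfl

theorem sat_lt {ts : Fin 2 → (lang k).Term (α ⊕ Fin m)} {v : α → WithTop Γ}
    {xs : Fin m → WithTop Γ} :
    Sat ψ P (Relations.boundedFormula (L := lang k) Rel.lt ts) v xs ↔
      termVal ψ P (Sum.elim v xs) (ts 0) < termVal ψ P (Sum.elim v xs) (ts 1) := Iff.rfl

theorem sat_cut {ts : Fin 1 → (lang k).Term (α ⊕ Fin m)} {v : α → WithTop Γ}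
    {xs : Fin m → WithTop Γ} :
    Sat ψ P (Relations.boundedFormula (L := lang k) Rel.cut ts) v xs ↔
      ∃ γ ∈ P, termVal ψ P (Sum.elim v xs) (ts 0) = (γ : WithTop Γ) := Iff.rfl

theorem sat_not {φ : (lang k).BoundedFormula α m} {v : α → WithTop Γ}
    {xs : Fin m → WithTop Γ} : Sat ψ P φ.not v xs ↔ ¬ Sat ψ P φ v xs := Iff.rfl

theorem sat_all {φ : (lang k).BoundedFormula α (m + 1)} {v : α → WithTop Γ}
    {xs : Fin m → WithTop Γ} : Sat ψ P φ.all v xs ↔ ∀ y, Sat ψ P φ v (Fin.snoc xs y) := Iff.rfl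

theorem sat_iSup {β : Type*} [Finite β] {f : β → (lang k).BoundedFormula α m}
    {v : α → WithTop Γ} {xs : Fin m → WithTop Γ} :
    Sat ψ P (BoundedFormula.iSup f) v xs ↔ ∃ b, Sat ψ P (f b) v xs :=
  let _ := toStructure k ψ P
  BoundedFormula.realize_iSup

theorem sat_iInf {β : Type*} [Finite β] {f : β → (lang k).BoundedFormula α m}
    {v : α → WithTop Γ} {xs : Fin m → WithTop Γ} :
    Sat ψ P (BoundedFormula.iInf f) v xs ↔ ∀ b, Sat ψ P (f b) v xs :=
  let _ := toStructure k ψ P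
  BoundedFormula.realize_iInf

theorem psiTop_coe_of_ne {x : Γ} (hx : x ≠ 0) : psiTop ψ (x : WithTop Γ) = (ψ x : WithTop Γ) :=
  if_neg hx

theorem psiTop_zero : psiTop ψ ((0 : Γ) : WithTop Γ) = ⊤ := if_pos rfl

end Semantics

theorem isQF_iSup {L : Language} {α β : Type*} {m : ℕ} [Finite β]
    {f : β → L.BoundedFormula α m} (hf : ∀ b, (f b).IsQF) : (BoundedFormula.iSup f).IsQF := by
  rw [BoundedFormula.iSup]
  generalize Finset.toList _ = l
  induction l with
  | nil => exact BoundedFormula.isQF_bot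
  | cons b l ih => exact (hf b).sup ih

theorem isQF_iInf {L : Language} {α β : Type*} {m : ℕ} [Finite β]
    {f : β → L.BoundedFormula α m} (hf : ∀ b, (f b).IsQF) : (BoundedFormula.iInf f).IsQF := by
  rw [BoundedFormula.iInf]
  generalize Finset.toList _ = l
  induction l with
  | nil => exact BoundedFormula.IsQF.top
  | cons b l ih => exact (hf b).inf ih

/-! ### Partial isomorphisms and quantifier-free formulas -/

section GraphSemantics

variable {k : Type*} [Field k] [LinearOrder k] [IsStrictOrderedRing k]
  {M : Type*} [AddCommGroup M] [LinearOrder M] [IsOrderedAddMonoid M]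
  [Module k M] [PosSMulStrictMono k M]
  {N : Type*} [AddCommGroup N] [LinearOrder N] [IsOrderedAddMonoid N]
  [Module k N] [PosSMulStrictMono k N]
  {ψ : M → M} {P : Set M} {ψ₁ : N → N} {P₁ : Set N} {G : Submodule k (M × N)}
  {α : Type*} {m : ℕ}

/-- The extension of the relation `G` by `∞ ↦ ∞`. -/
def TopRel (G : Submodule k (M × N)) (x : WithTop M) (y : WithTop N) : Prop :=
  (x = ⊤ ∧ y = ⊤) ∨ ∃ p ∈ G, x = p.1 ∧ y = p.2

theorem IsOrderGraph.topRel_eq_iff (hG : IsOrderGraph G) {x x' : WithTop M} {y y' : WithTop N}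
    (h : TopRel G x y) (h' : TopRel G x' y') : x = x' ↔ y = y' := by
  rcases h with ⟨rfl, rfl⟩ | ⟨p, hp, rfl, rfl⟩ <;>
    rcases h' with ⟨rfl, rfl⟩ | ⟨q, hq, rfl, rfl⟩ <;> simp [hG.eq_iff, *]

theorem IsOrderGraph.topRel_lt_iff (hG : IsOrderGraph G) {x x' : WithTop M} {y y' : WithTop N}
    (h : TopRel G x y) (h' : TopRel G x' y') : x < x' ↔ y < y' := by
  rcases h with ⟨rfl, rfl⟩ | ⟨p, hp, rfl, rfl⟩ <;>
    rcases h' with ⟨rfl, rfl⟩ | ⟨q, hq, rfl, rfl⟩ <;> simp [hG.lt_iff, *]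

theorem IsIsoGraph.topRel_termVal (hG : IsIsoGraph ψ P ψ₁ P₁ G) {v : α → WithTop M}
    {v' : α → WithTop N} (hv : ∀ i, TopRel G (v i) (v' i)) (t : (lang k).Term α) :
    TopRel G (termVal ψ P v t) (termVal ψ₁ P₁ v' t) := by
  induction t with
  | var i => exact hv i
  | func f ts ih =>
    cases f with
    | zero => exact Or.inr ⟨0, G.zero_mem, rfl, rfl⟩
    | infty => exact Or.inl ⟨rfl, rfl⟩
    | neg =>
      change TopRel G (WithTop.map _ (termVal ψ P v (ts 0)))
        (WithTop.map _ (termVal ψ₁ P₁ v' (ts 0)))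
      rcases ih 0 with ⟨h1, h2⟩ | ⟨p, hp, h1, h2⟩ <;> rw [h1, h2]
      · exact Or.inl ⟨rfl, rfl⟩
      · exact Or.inr ⟨-p, G.neg_mem hp, rfl, rfl⟩
    | psi =>
      change TopRel G (psiTop ψ (termVal ψ P v (ts 0))) (psiTop ψ₁ (termVal ψ₁ P₁ v' (ts 0)))
      rcases ih 0 with ⟨h1, h2⟩ | ⟨p, hp, h1, h2⟩ <;> rw [h1, h2]
      · exact Or.inl ⟨rfl, rfl⟩
      · rcases eq_or_ne p.1 0 with h0 | h0
        · rw [h0, (hG.order.eq_zero_iff hp).1 h0]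
          exact Or.inl ⟨psiTop_zero, psiTop_zero⟩
        · refine Or.inr ⟨_, hG.psi_mem p hp h0, psiTop_coe_of_ne h0, psiTop_coe_of_ne fun h => ?_⟩
          exact h0 ((hG.order.eq_zero_iff hp).2 h)
    | smul c =>
      change TopRel G (WithTop.map _ (termVal ψ P v (ts 0)))
        (WithTop.map _ (termVal ψ₁ P₁ v' (ts 0)))
      rcases ih 0 with ⟨h1, h2⟩ | ⟨p, hp, h1, h2⟩ <;> rw [h1, h2]
      · exact Or.inl ⟨rfl, rfl⟩
      · exact Or.inr ⟨c • p, G.smul_mem c hp, rfl, rfl⟩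
    | add =>
      change TopRel G (termVal ψ P v (ts 0) + termVal ψ P v (ts 1))
        (termVal ψ₁ P₁ v' (ts 0) + termVal ψ₁ P₁ v' (ts 1))
      rcases ih 0 with ⟨h1, h2⟩ | ⟨p, hp, h1, h2⟩ <;>
        rcases ih 1 with ⟨h3, h4⟩ | ⟨q, hq, h3, h4⟩ <;> rw [h1, h2, h3, h4]
      · exact Or.inl ⟨rfl, rfl⟩
      · exact Or.inl ⟨rfl, rfl⟩
      · exact Or.inl ⟨rfl, rfl⟩
      · exact Or.inr ⟨p + q, G.add_mem hp hq, rfl, rfl⟩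

/-- Partial isomorphisms preserve quantifier-free formulas. -/
theorem IsIsoGraph.sat_iff (hG : IsIsoGraph ψ P ψ₁ P₁ G) {φ : (lang k).BoundedFormula α m}
    (hφ : φ.IsQF) {v : α → WithTop M} {v' : α → WithTop N} (hv : ∀ i, TopRel G (v i) (v' i))
    {xs : Fin m → WithTop M} {xs' : Fin m → WithTop N} (hxs : ∀ i, TopRel G (xs i) (xs' i)) :
    Sat ψ P φ v xs ↔ Sat ψ₁ P₁ φ v' xs' := by
  have hvx : ∀ i, TopRel G (Sum.elim v xs i) (Sum.elim v' xs' i) := by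
    rintro (i | i)
    exacts [hv i, hxs i]
  induction hφ with
  | falsum => exact Iff.rfl
  | of_isAtomic h =>
    cases h with
    | equal t₁ t₂ =>
      rw [sat_equal, sat_equal]
      exact hG.order.topRel_eq_iff (hG.topRel_termVal hvx t₁) (hG.topRel_termVal hvx t₂)
    | rel R ts =>
      cases R with
      | lt =>
        rw [sat_lt, sat_lt]
        exact hG.order.topRel_lt_iff (hG.topRel_termVal hvx _) (hG.topRel_termVal hvx _)
      | cut =>
        rw [sat_cut, sat_cut]
        rcases hG.topRel_termVal hvx (ts 0) with ⟨h1, h2⟩ | ⟨p, hp, h1, h2⟩ <;> rw [h1, h2]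
        · simp
        · simpa using hG.cut_iff p hp
  | imp _ _ ih₁ ih₂ => exact imp_congr ih₁ ih₂

/-- The pairs of values of terms at two given tuples. -/
def termGraph (ψ : M → M) (P : Set M) (ψ₁ : N → N) (P₁ : Set N) (v : α → WithTop M)
    (v' : α → WithTop N) : Submodule k (M × N) where
  carrier := {p | ∃ t : (lang k).Term α, termVal ψ P v t = p.1 ∧ termVal ψ₁ P₁ v' t = p.2}
  add_mem' := by
    rintro p q ⟨t, ht, ht'⟩ ⟨s, hs, hs'⟩
    refine ⟨Term.func (L := lang k) Func.add ![t, s], ?_, ?_⟩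
    · change termVal ψ P v t + termVal ψ P v s = _
      rw [ht, hs]
      rfl
    · change termVal ψ₁ P₁ v' t + termVal ψ₁ P₁ v' s = _
      rw [ht', hs']
      rfl
  zero_mem' := ⟨Term.func (L := lang k) Func.zero ![], rfl, rfl⟩
  smul_mem' := by
    rintro c p ⟨t, ht, ht'⟩
    refine ⟨Term.func (L := lang k) (Func.smul c) ![t], ?_, ?_⟩
    · change WithTop.map _ (termVal ψ P v t) = _
      rw [ht]
      rfl
    · change WithTop.map _ (termVal ψ₁ P₁ v' t) = _
      rw [ht']
      rfl

/-- Tuples with the same quantifier-free type correspond under a partial isomorphism. -/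
theorem exists_isIsoGraph {v : α → WithTop M} {xs : Fin m → WithTop M} {v' : α → WithTop N}
    {xs' : Fin m → WithTop N}
    (h : ∀ φ : (lang k).BoundedFormula α m, φ.IsQF → (Sat ψ P φ v xs ↔ Sat ψ₁ P₁ φ v' xs')) :
    ∃ G : Submodule k (M × N), IsIsoGraph ψ P ψ₁ P₁ G ∧ (∀ i, TopRel G (v i) (v' i)) ∧
      ∀ i, TopRel G (xs i) (xs' i) := by
  set a := Sum.elim v xs with ha
  set b := Sum.elim v' xs' with hb
  let G : Submodule k (M × N) := termGraph ψ P ψ₁ P₁ a b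
  have hord : IsOrderGraph G := by
    rintro p ⟨t, ht, ht'⟩
    have := h (Relations.boundedFormula (L := lang k) Rel.lt
      ![Term.func (L := lang k) Func.zero ![], t]) (BoundedFormula.IsAtomic.rel _ _).isQF
    rw [sat_lt, sat_lt] at this
    change ((0 : M) : WithTop M) < termVal ψ P a t ↔
      ((0 : N) : WithTop N) < termVal ψ₁ P₁ b t at this
    rwa [ht, ht', WithTop.coe_lt_coe, WithTop.coe_lt_coe] at this
  have hvar : ∀ i, TopRel G (a i) (b i) := by
    intro i
    have := h ((Term.var i).bdEqual (Term.func (L := lang k) Func.infty ![]))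
      (BoundedFormula.IsAtomic.equal _ _).isQF
    rw [sat_equal, sat_equal] at this
    change a i = ⊤ ↔ b i = ⊤ at this
    by_cases h0 : a i = ⊤
    · exact Or.inl ⟨h0, this.1 h0⟩
    · obtain ⟨x, hx⟩ := WithTop.ne_top_iff_exists.1 h0
      obtain ⟨y, hy⟩ := WithTop.ne_top_iff_exists.1 (fun h1 => h0 (this.2 h1))
      exact Or.inr ⟨(x, y), ⟨Term.var i, hx.symm, hy.symm⟩, hx.symm, hy.symm⟩
  refine ⟨G, ⟨hord, ?_, ?_⟩, fun i => hvar (Sum.inl i), fun i => hvar (Sum.inr i)⟩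
  · rintro p hp hp0
    have hp1 : p.2 ≠ 0 := fun h1 => hp0 ((hord.eq_zero_iff hp).2 h1)
    obtain ⟨t, ht, ht'⟩ := hp
    refine ⟨Term.func (L := lang k) Func.psi ![t], ?_, ?_⟩
    · change psiTop ψ (termVal ψ P a t) = _
      rw [ht, psiTop_coe_of_ne hp0]
    · change psiTop ψ₁ (termVal ψ₁ P₁ b t) = _
      rw [ht', psiTop_coe_of_ne hp1]
  · rintro p ⟨t, ht, ht'⟩
    have := h (Relations.boundedFormula (L := lang k) Rel.cut ![t])
      (BoundedFormula.IsAtomic.rel _ _).isQF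
    rw [sat_cut, sat_cut] at this
    change (∃ γ ∈ P, termVal ψ P a t = (γ : WithTop M)) ↔
      ∃ γ ∈ P₁, termVal ψ₁ P₁ b t = (γ : WithTop N) at this
    rw [ht, ht'] at this
    simpa using this

/-- Existential formulas transfer between tuples of the same quantifier-free type, in the direction
of a saturated closed H-triple. -/
theorem exists_sat_of_isSaturated [Countable k] (h : IsClosedHTriple k ψ P)
    (h₁ : IsClosedHTriple k ψ₁ P₁) (hsat : IsSaturated ψ₁ P₁) [Countable α]
    {v : α → WithTop M} {xs : Fin m → WithTop M} {v' : α → WithTop N} {xs' : Fin m → WithTop N}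
    (hqf : ∀ φ : (lang k).BoundedFormula α m, φ.IsQF → (Sat ψ P φ v xs ↔ Sat ψ₁ P₁ φ v' xs'))
    {θ : (lang k).BoundedFormula α (m + 1)} (hθ : θ.IsQF) (hex : ∃ y, Sat ψ P θ v (Fin.snoc xs y)) :
    ∃ y, Sat ψ₁ P₁ θ v' (Fin.snoc xs' y) := by
  obtain ⟨y, hy⟩ := hex
  -- Only countable saturation is available, so the parameters and the witness are first moved into
  -- a countable closed sub-H-triple.
  have hS : ((fun x : M => (x : WithTop M)) ⁻¹'
      (Set.range v ∪ Set.range xs ∪ {y})).Countable :=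
    ((((Set.countable_range v).union (Set.countable_range xs)).union
      (Set.countable_singleton y))).preimage WithTop.coe_injective
  obtain ⟨K, ψK, hK, hSK, hψK, hKc⟩ := h.exists_countable hS
  let I : Submodule k (K × M) := LinearMap.graph K.subtype
  have hI : IsIsoGraph ψK {x : K | (x : M) ∈ P} ψ P I := by
    refine ⟨?_, ?_, ?_⟩
    · rintro ⟨x, z⟩ (rfl : z = x)
      exact Iff.rfl
    · rintro ⟨x, z⟩ (rfl : z = x) -
      exact (hψK x).symm
    · rintro ⟨x, z⟩ (rfl : z = x)
      exact Iff.rfl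
  have hlift : ∀ z ∈ Set.range v ∪ Set.range xs ∪ {y}, ∃ z' : WithTop K, TopRel I z' z := by
    intro z hz
    induction z using WithTop.recTopCoe with
    | top => exact ⟨⊤, Or.inl ⟨rfl, rfl⟩⟩
    | coe z => exact ⟨((⟨z, hSK hz⟩ : K) : WithTop K), Or.inr ⟨(⟨z, hSK hz⟩, z), rfl, rfl, rfl⟩⟩
  choose vK hvK using fun i => hlift (v i) (Or.inl (Or.inl ⟨i, rfl⟩))
  choose xK hxK using fun i => hlift (xs i) (Or.inl (Or.inr ⟨i, rfl⟩))
  obtain ⟨yK, hyK⟩ := hlift y (Or.inr rfl)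
  obtain ⟨G, hG, hGv, hGx⟩ := exists_isIsoGraph (ψ := ψK) (P := {x : K | (x : M) ∈ P}) (v := vK)
    (xs := xK) (ψ₁ := ψ₁) (P₁ := P₁) (v' := v') (xs' := xs') (k := k) fun φ hφ =>
      (hI.sat_iff hφ hvK hxK).trans (hqf φ hφ)
  obtain ⟨G', hle, hG', htot⟩ := hG.exists_total hKc h₁ hsat
  have hmono : ∀ {x z}, TopRel G x z → TopRel G' x z := fun hxz =>
    hxz.imp_right fun ⟨p, hp, hpx⟩ => ⟨p, hle hp, hpx⟩
  have hyN : ∃ z, TopRel G' yK z := by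
    induction yK using WithTop.recTopCoe with
    | top => exact ⟨⊤, Or.inl ⟨rfl, rfl⟩⟩
    | coe x =>
      obtain ⟨z, hz⟩ := htot x
      exact ⟨z, Or.inr ⟨_, hz, rfl, rfl⟩⟩
  obtain ⟨z, hz⟩ := hyN
  refine ⟨z, ?_⟩
  have h2 : Sat ψK {x : K | (x : M) ∈ P} θ vK (Fin.snoc xK yK) := by
    refine (hI.sat_iff hθ hvK fun i => ?_).2 hy
    refine Fin.lastCases ?_ (fun i => ?_) i
    · simpa using hyK
    · simpa using hxK i
  refine (hG'.sat_iff hθ (fun i => hmono (hGv i)) fun i => ?_).1 h2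
  refine Fin.lastCases ?_ (fun i => ?_) i
  · simpa using hz
  · simpa using hmono (hGx i)

end GraphSemantics

/-! ### Łoś's theorem for quantifier-free formulas -/

section Los

open Filter Ultraproduct

variable {k : Type*} [Field k] [LinearOrder k] [IsStrictOrderedRing k]
  {Γ : ℕ → Type*} [∀ n, AddCommGroup (Γ n)] [∀ n, LinearOrder (Γ n)]
  [∀ n, IsOrderedAddMonoid (Γ n)] [∀ n, Module k (Γ n)] [∀ n, PosSMulStrictMono k (Γ n)]
  {U : Ultrafilter ℕ} {ψ : ∀ n, Γ n → Γ n} {P : ∀ n, Set (Γ n)} {α : Type*} {m : ℕ}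

/-- The sequence `f` represents the element `x` of the ultraproduct with `∞` adjoined. -/
def SeqRel (f : ∀ n, WithTop (Γ n)) (x : WithTop (Ultraproduct k Γ U)) : Prop :=
  ((∀ᶠ n in U, f n = ⊤) ∧ x = ⊤) ∨
    ∃ g : ∀ n, Γ n, (∀ᶠ n in U, f n = (g n : WithTop (Γ n))) ∧ x = (mk k Γ U g)

theorem exists_seqRel (x : WithTop (Ultraproduct k Γ U)) :
    ∃ f : ∀ n, WithTop (Γ n), SeqRel f x := by
  induction x using WithTop.recTopCoe with
  | top => exact ⟨fun _ => ⊤, Or.inl ⟨Eventually.of_forall fun _ => rfl, rfl⟩⟩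
  | coe x =>
    obtain ⟨g, rfl⟩ := mk_surjective x
    exact ⟨fun n => g n, Or.inr ⟨g, Eventually.of_forall fun _ => rfl, rfl⟩⟩

variable (k U) in
theorem exists_seqRel_left (f : ∀ n, WithTop (Γ n)) :
    ∃ x : WithTop (Ultraproduct k Γ U), SeqRel f x := by
  by_cases h : ∀ᶠ n in U, f n = ⊤
  · exact ⟨⊤, Or.inl ⟨h, rfl⟩⟩
  -- The default `0` is used only at indices with `f n = ⊤`, a `U`-null set here.
  · refine ⟨_, Or.inr ⟨fun n => (f n).untopD 0, ?_, rfl⟩⟩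
    filter_upwards [Ultrafilter.eventually_not.2 h] with n hn
    obtain ⟨x, hx⟩ := WithTop.ne_top_iff_exists.1 hn
    rw [← hx]
    rfl

theorem eventually_false_iff {p : ℕ → Prop} (h : ∀ᶠ n in U, ¬ p n) : ¬ ∀ᶠ n in U, p n :=
  Ultrafilter.eventually_not.1 h

theorem seqRel_eq_iff {f f' : ∀ n, WithTop (Γ n)} {x x' : WithTop (Ultraproduct k Γ U)}
    (h : SeqRel f x) (h' : SeqRel f' x') : x = x' ↔ ∀ᶠ n in U, f n = f' n := by
  rcases h with ⟨h, rfl⟩ | ⟨g, h, rfl⟩ <;> rcases h' with ⟨h', rfl⟩ | ⟨g', h', rfl⟩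
  · refine iff_of_true rfl ?_
    filter_upwards [h, h'] with n h1 h2
    rw [h1, h2]
  · refine iff_of_false WithTop.top_ne_coe (eventually_false_iff ?_)
    filter_upwards [h, h'] with n h1 h2
    simp [h1, h2]
  · refine iff_of_false WithTop.coe_ne_top (eventually_false_iff ?_)
    filter_upwards [h, h'] with n h1 h2
    simp [h1, h2]
  · rw [WithTop.coe_inj, mk_eq_mk]
    refine eventually_congr ?_
    filter_upwards [h, h'] with n h1 h2
    rw [h1, h2, WithTop.coe_inj]

theorem seqRel_lt_iff {f f' : ∀ n, WithTop (Γ n)} {x x' : WithTop (Ultraproduct k Γ U)}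
    (h : SeqRel f x) (h' : SeqRel f' x') : x < x' ↔ ∀ᶠ n in U, f n < f' n := by
  rcases h with ⟨h, rfl⟩ | ⟨g, h, rfl⟩
  · refine iff_of_false not_top_lt (eventually_false_iff ?_)
    filter_upwards [h] with n h1
    simp [h1]
  rcases h' with ⟨h', rfl⟩ | ⟨g', h', rfl⟩
  · refine iff_of_true (WithTop.coe_lt_top _) ?_
    filter_upwards [h, h'] with n h1 h2
    simp [h1, h2]
  · rw [WithTop.coe_lt_coe, mk_lt_mk]
    refine eventually_congr ?_
    filter_upwards [h, h'] with n h1 h2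
    rw [h1, h2, WithTop.coe_lt_coe]

theorem seqRel_termVal {v : ∀ n, α → WithTop (Γ n)} {V : α → WithTop (Ultraproduct k Γ U)}
    (hv : ∀ i, SeqRel (fun n => v n i) (V i)) (t : (lang k).Term α) :
    SeqRel (fun n => termVal (ψ n) (P n) (v n) t)
      (termVal (Ultraproduct.map ψ) (Ultraproduct.cut k U P) V t) := by
  induction t with
  | var i => exact hv i
  | func f ts ih =>
    cases f with
    | zero =>
      refine Or.inr ⟨0, Eventually.of_forall fun n => rfl, ?_⟩
      rw [map_zero]
      rfl
    | infty => exact Or.inl ⟨Eventually.of_forall fun n => rfl, rfl⟩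
    | neg =>
      change SeqRel (fun n => WithTop.map _ (termVal (ψ n) (P n) (v n) (ts 0)))
        (WithTop.map _ (termVal (Ultraproduct.map ψ) (Ultraproduct.cut k U P) V (ts 0)))
      rcases ih 0 with ⟨h1, h2⟩ | ⟨g, h1, h2⟩ <;> rw [h2]
      · exact Or.inl ⟨h1.mono fun n hn => by dsimp only at hn ⊢; rw [hn]; rfl, rfl⟩
      · refine Or.inr ⟨-g, h1.mono fun n hn => by dsimp only at hn ⊢; rw [hn]; rfl, ?_⟩
        rw [map_neg]
        rfl
    | psi =>
      change SeqRel (fun n => psiTop (ψ n) (termVal (ψ n) (P n) (v n) (ts 0)))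
        (psiTop _ (termVal (Ultraproduct.map ψ) (Ultraproduct.cut k U P) V (ts 0)))
      rcases ih 0 with ⟨h1, h2⟩ | ⟨g, h1, h2⟩ <;> rw [h2]
      · exact Or.inl ⟨h1.mono fun n hn => by dsimp only at hn ⊢; rw [hn]; rfl, rfl⟩
      · by_cases h0 : mk k Γ U g = 0
        · have h3 : ∀ᶠ n in U, g n = 0 := by
            rw [← map_zero (mk k Γ U), mk_eq_mk] at h0
            exact h0
          rw [h0]
          refine Or.inl ⟨?_, psiTop_zero⟩
          filter_upwards [h1, h3] with n h4 h5
          rw [h4, h5, psiTop_zero]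
        · refine Or.inr ⟨fun n => ψ n (g n), ?_, ?_⟩
          · filter_upwards [h1, mk_ne_zero.1 h0] with n h4 h5
            rw [h4, psiTop_coe_of_ne h5]
          · rw [psiTop_coe_of_ne h0, map_mk]
    | smul c =>
      change SeqRel (fun n => WithTop.map _ (termVal (ψ n) (P n) (v n) (ts 0)))
        (WithTop.map _ (termVal (Ultraproduct.map ψ) (Ultraproduct.cut k U P) V (ts 0)))
      rcases ih 0 with ⟨h1, h2⟩ | ⟨g, h1, h2⟩ <;> rw [h2]
      · exact Or.inl ⟨h1.mono fun n hn => by dsimp only at hn ⊢; rw [hn]; rfl, rfl⟩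
      · refine Or.inr ⟨c • g, h1.mono fun n hn => by dsimp only at hn ⊢; rw [hn]; rfl, ?_⟩
        rw [map_smul]
        rfl
    | add =>
      change SeqRel (fun n => termVal (ψ n) (P n) (v n) (ts 0) + termVal (ψ n) (P n) (v n) (ts 1))
        (termVal (Ultraproduct.map ψ) (Ultraproduct.cut k U P) V (ts 0) +
          termVal (Ultraproduct.map ψ) (Ultraproduct.cut k U P) V (ts 1))
      rcases ih 0 with ⟨h1, h2⟩ | ⟨g, h1, h2⟩
      · rw [h2, top_add]
        exact Or.inl ⟨h1.mono fun n hn => by dsimp only at hn ⊢; rw [hn, top_add], rfl⟩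
      rcases ih 1 with ⟨h3, h4⟩ | ⟨g', h3, h4⟩
      · rw [h4, add_top]
        exact Or.inl ⟨h3.mono fun n hn => by dsimp only at hn ⊢; rw [hn, add_top], rfl⟩
      · rw [h2, h4]
        refine Or.inr ⟨g + g', ?_, ?_⟩
        · filter_upwards [h1, h3] with n h5 h6
          rw [h5, h6]
          rfl
        · rw [map_add]
          rfl

theorem sat_ultraproduct_iff {φ : (lang k).BoundedFormula α m} (hφ : φ.IsQF)
    {v : ∀ n, α → WithTop (Γ n)} {V : α → WithTop (Ultraproduct k Γ U)}
    (hv : ∀ i, SeqRel (fun n => v n i) (V i)) {xs : ∀ n, Fin m → WithTop (Γ n)}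
    {X : Fin m → WithTop (Ultraproduct k Γ U)} (hX : ∀ i, SeqRel (fun n => xs n i) (X i)) :
    Sat (Ultraproduct.map ψ) (Ultraproduct.cut k U P) φ V X ↔
      ∀ᶠ n in U, Sat (ψ n) (P n) φ (v n) (xs n) := by
  have hvx : ∀ i, SeqRel (fun n => Sum.elim (v n) (xs n) i) (Sum.elim V X i) := by
    rintro (i | i)
    exacts [hv i, hX i]
  have ht := seqRel_termVal (ψ := ψ) (P := P) hvx
  induction hφ with
  | falsum => exact iff_of_false id (eventually_false_iff (Eventually.of_forall fun n => id))
  | of_isAtomic h =>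
    cases h with
    | equal t₁ t₂ =>
      rw [sat_equal]
      exact seqRel_eq_iff (ht t₁) (ht t₂)
    | rel R ts =>
      cases R with
      | lt =>
        rw [sat_lt]
        exact seqRel_lt_iff (ht _) (ht _)
      | cut =>
        simp only [sat_cut]
        rcases ht (ts 0) with ⟨h1, h2⟩ | ⟨g, h1, h2⟩ <;> rw [h2]
        · refine iff_of_false (by simp) (eventually_false_iff ?_)
          filter_upwards [h1] with n h3
          simp [h3]
        · simp only [WithTop.coe_inj, exists_eq_right', mk_mem_cut]
          refine eventually_congr ?_
          filter_upwards [h1] with n h3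
          simp [h3]
  | imp _ _ ih₁ ih₂ =>
    exact (imp_congr ih₁ ih₂).trans Ultrafilter.eventually_imp.symm

end Los

open FirstOrder Language

/-! ### Quantifier elimination over countable fields -/

/-- A closed H-triple over `k`, bundled. -/
structure ClosedTriple (k : Type u) [Field k] [LinearOrder k] where
  /-- The underlying ordered vector space. -/
  carrier : Type w
  [group : AddCommGroup carrier]
  [order : LinearOrder carrier]
  [ordered : IsOrderedAddMonoid carrier]
  [module : Module k carrier]
  [posSMul : PosSMulStrictMono k carrier]
  /-- The map `ψ`. -/
  psi : carrier → carrier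
  /-- The H-cut. -/
  cut : Set carrier
  closed : IsClosedHTriple k psi cut

namespace ClosedTriple

attribute [instance] group order ordered module posSMul

end ClosedTriple

section CountableField

variable {k : Type u} [Field k] [LinearOrder k] [IsStrictOrderedRing k] {α : Type} {m : ℕ}

/-- Two sets of tuples in closed H-triples that are not separated by any Boolean combination of
finitely many given formulas contain tuples on which these formulas agree. -/
theorem exists_agree {p : ∀ T : ClosedTriple.{u, w} k, (α → WithTop T.carrier) →
      (Fin m → WithTop T.carrier) → Prop}
    (hp : ¬ ∃ θ : (lang k).BoundedFormula α m, θ.IsQF ∧ ∀ T : ClosedTriple.{u, w} k, ∀ v xs,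
      Sat T.psi T.cut θ v xs ↔ p T v xs)
    {j : ℕ} {e : Fin j → (lang k).BoundedFormula α m} (he : ∀ i, (e i).IsQF) :
    ∃ (T : ClosedTriple.{u, w} k) (v : α → WithTop T.carrier) (xs : Fin m → WithTop T.carrier)
      (T' : ClosedTriple.{u, w} k) (v' : α → WithTop T'.carrier) (xs' : Fin m → WithTop T'.carrier),
      p T v xs ∧ ¬ p T' v' xs' ∧
        ∀ i, Sat T.psi T.cut (e i) v xs ↔ Sat T'.psi T'.cut (e i) v' xs' := by
  classical
  by_contra! hc
  -- `B` lists the truth patterns of the `e i` at tuples satisfying `p`. If agreement of patterns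
  -- always preserved `p`, the disjunction over `B` would define `p`.
  let B := {s : Set (Fin j) // ∃ (T : ClosedTriple.{u, w} k) (v : α → WithTop T.carrier)
    (xs : Fin m → WithTop T.carrier), p T v xs ∧ ∀ i, i ∈ s ↔ Sat T.psi T.cut (e i) v xs}
  refine hp ⟨BoundedFormula.iSup fun s : B => BoundedFormula.iInf fun i =>
    if i ∈ s.1 then e i else (e i).not, isQF_iSup fun s => isQF_iInf fun i => ?_,
    fun T v xs => ?_⟩
  · split_ifs
    exacts [he i, (he i).not]
  have hiff : ∀ s : B, (∀ i, Sat T.psi T.cut (if i ∈ s.1 then e i else (e i).not) v xs) ↔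
      ∀ i, i ∈ s.1 ↔ Sat T.psi T.cut (e i) v xs := fun s => forall_congr' fun i => by
    split_ifs with h
    · simp [h]
    · simp [h, sat_not]
  simp only [sat_iSup, sat_iInf, hiff]
  constructor
  · rintro ⟨⟨s, T', v', xs', hp', hs'⟩, hs⟩
    by_contra hn
    obtain ⟨i, hi⟩ := hc T' v' xs' T v xs hp' hn
    have h1 : Sat T'.psi T'.cut (e i) v' xs' ↔ Sat T.psi T.cut (e i) v xs :=
      (hs' i).symm.trans (hs i)
    rcases hi with hi | hi
    · exact hi.2 (h1.1 hi.1)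
    · exact hi.1 (h1.2 hi.2)
  · intro hpT
    exact ⟨⟨{i | Sat T.psi T.cut (e i) v xs}, T, v, xs, hpT, fun i => Iff.rfl⟩, fun i => Iff.rfl⟩

instance [Countable k] : Countable (lang k).Symbols := by
  have h1 : Countable (Σ l, (lang k).Functions l) := by
    refine Function.Surjective.countable (α := Fin 5 ⊕ k)
      (f := fun x => match x with
        | Sum.inl 0 => ⟨0, Func.zero⟩
        | Sum.inl 1 => ⟨0, Func.infty⟩
        | Sum.inl 2 => ⟨1, Func.neg⟩
        | Sum.inl 3 => ⟨1, Func.psi⟩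
        | Sum.inl 4 => ⟨2, Func.add⟩
        | Sum.inr c => ⟨1, Func.smul c⟩) ?_
    rintro ⟨l, f⟩
    cases f with
    | zero => exact ⟨Sum.inl 0, rfl⟩
    | infty => exact ⟨Sum.inl 1, rfl⟩
    | neg => exact ⟨Sum.inl 2, rfl⟩
    | psi => exact ⟨Sum.inl 3, rfl⟩
    | smul c => exact ⟨Sum.inr c, rfl⟩
    | add => exact ⟨Sum.inl 4, rfl⟩
  have h2 : Countable (Σ l, (lang k).Relations l) := by
    refine Function.Surjective.countable (α := Bool)
      (f := fun x => match x with
        | true => ⟨1, Rel.cut⟩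
        | false => ⟨2, Rel.lt⟩) ?_
    rintro ⟨l, R⟩
    cases R with
    | cut => exact ⟨true, rfl⟩
    | lt => exact ⟨false, rfl⟩
  exact inferInstanceAs (Countable ((Σ l, (lang k).Functions l) ⊕ (Σ l, (lang k).Relations l)))

/-- Elimination of one existential quantifier. -/
theorem exists_isQF_iff_exists [Countable k] [Finite α] {θ : (lang k).BoundedFormula α (m + 1)}
    (hθ : θ.IsQF) :
    ∃ θ' : (lang k).BoundedFormula α m, θ'.IsQF ∧ ∀ T : ClosedTriple.{u, w} k, ∀ v xs,
      Sat T.psi T.cut θ' v xs ↔ ∃ y, Sat T.psi T.cut θ v (Fin.snoc xs y) := by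
  by_contra hne
  have hcount : Countable {φ : (lang k).BoundedFormula α m // φ.IsQF} :=
    Function.Injective.countable
      (f := fun φ => (⟨m, φ.1⟩ : Σ n, (lang k).BoundedFormula α n))
      (sigma_mk_injective.comp Subtype.val_injective)
  have : Nonempty {φ : (lang k).BoundedFormula α m // φ.IsQF} :=
    ⟨⟨⊥, BoundedFormula.isQF_bot⟩⟩
  obtain ⟨e, he⟩ := exists_surjective_nat {φ : (lang k).BoundedFormula α m // φ.IsQF}
  -- The `j`-th pair agrees on the first `j` quantifier-free formulas, but only its first tuple has
  -- a witness for `θ`. The ultraproducts then agree on all of them.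
  choose T v xs T' v' xs' hT hT' hagree using fun j : ℕ =>
    exists_agree hne (e := fun i : Fin j => (e i).1) fun i => (e i).2
  let U := Filter.hyperfilter ℕ
  have hU : (U : Filter ℕ) ≤ Filter.atTop := Nat.hyperfilter_le_atTop
  choose V hV using fun i => exists_seqRel_left k U fun n => v n i
  choose X hX using fun i => exists_seqRel_left k U fun n => xs n i
  choose V' hV' using fun i => exists_seqRel_left k U fun n => v' n i
  choose X' hX' using fun i => exists_seqRel_left k U fun n => xs' n i
  have hqf : ∀ φ : (lang k).BoundedFormula α m, φ.IsQF →
      (Sat (Ultraproduct.map fun n => (T n).psi) (Ultraproduct.cut k U fun n => (T n).cut) φ V X ↔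
        Sat (Ultraproduct.map fun n => (T' n).psi) (Ultraproduct.cut k U fun n => (T' n).cut)
          φ V' X') := by
    intro φ hφ
    rw [sat_ultraproduct_iff hφ hV hX, sat_ultraproduct_iff hφ hV' hX']
    obtain ⟨i, hi⟩ := he ⟨φ, hφ⟩
    refine Filter.eventually_congr ?_
    filter_upwards [hU (Filter.eventually_gt_atTop i)] with n hn
    have := hagree n ⟨i, hn⟩
    simpa only [hi] using this
  choose y hy using hT
  obtain ⟨Y, hY⟩ := exists_seqRel_left k U y
  have h1 : ∃ Y, Sat (Ultraproduct.map fun n => (T n).psi)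
      (Ultraproduct.cut k U fun n => (T n).cut) θ V (Fin.snoc X Y) := by
    refine ⟨Y, (sat_ultraproduct_iff hθ hV (xs := fun n => Fin.snoc (xs n) (y n)) fun i => ?_).2
      (Filter.Eventually.of_forall hy)⟩
    refine Fin.lastCases ?_ (fun i => ?_) i
    · simpa using hY
    · simpa using hX i
  obtain ⟨Y', hY'⟩ := exists_sat_of_isSaturated
    (Ultraproduct.isClosedHTriple fun n => (T n).closed)
    (Ultraproduct.isClosedHTriple fun n => (T' n).closed) (Ultraproduct.isSaturated hU _ _) hqf hθ h1
  obtain ⟨y', hy'⟩ := exists_seqRel Y'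
  have h2 : ∀ᶠ n in U, Sat (T' n).psi (T' n).cut θ (v' n) (Fin.snoc (xs' n) (y' n)) := by
    refine (sat_ultraproduct_iff hθ hV' (xs := fun n => Fin.snoc (xs' n) (y' n)) fun i => ?_).1 hY'
    refine Fin.lastCases ?_ (fun i => ?_) i
    · simpa using hy'
    · simpa using hX' i
  obtain ⟨n, hn⟩ := h2.exists
  exact hT' n ⟨_, hn⟩

theorem exists_isQF_iff_of_countable [Countable k] [Finite α] (φ : (lang k).BoundedFormula α m) :
    ∃ θ : (lang k).BoundedFormula α m, θ.IsQF ∧ ∀ T : ClosedTriple.{u, w} k, ∀ v xs,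
      Sat T.psi T.cut θ v xs ↔ Sat T.psi T.cut φ v xs := by
  induction φ with
  | falsum => exact ⟨⊥, BoundedFormula.isQF_bot, fun T v xs => Iff.rfl⟩
  | equal t₁ t₂ =>
    exact ⟨_, (BoundedFormula.IsAtomic.equal t₁ t₂).isQF, fun T v xs => Iff.rfl⟩
  | rel R ts => exact ⟨_, (BoundedFormula.IsAtomic.rel R ts).isQF, fun T v xs => Iff.rfl⟩
  | imp φ₁ φ₂ ih₁ ih₂ =>
    obtain ⟨θ₁, h₁, h₁'⟩ := ih₁
    obtain ⟨θ₂, h₂, h₂'⟩ := ih₂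
    exact ⟨θ₁.imp θ₂, h₁.imp h₂, fun T v xs => imp_congr (h₁' T v xs) (h₂' T v xs)⟩
  | all φ ih =>
    obtain ⟨θ, h, h'⟩ := ih
    obtain ⟨θ', h₁, h₁'⟩ := exists_isQF_iff_exists.{u, w} h.not
    refine ⟨θ'.not, h₁.not, fun T v xs => ?_⟩
    rw [sat_not, h₁', sat_all]
    simp only [sat_not, not_exists, not_not, h']

end CountableField

/-! ### Descent to countable subfields -/

section Descent

variable {k : Type u} [Field k] [LinearOrder k] [IsStrictOrderedRing k] {α : Type} {m : ℕ}

/-- The inclusion of the language over a subfield. -/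
def langInclusion (K : Subfield k) : lang K →ᴸ lang k where
  onFunction _ f := match f with
    | Func.zero => Func.zero
    | Func.infty => Func.infty
    | Func.neg => Func.neg
    | Func.psi => Func.psi
    | Func.smul c => Func.smul (c : k)
    | Func.add => Func.add
  onRelation _ R := R

theorem sat_langInclusion (K : Subfield k) {Γ : Type*} [AddCommGroup Γ] [LinearOrder Γ]
    [Module k Γ] {ψ : Γ → Γ} {P : Set Γ} (φ : (lang K).BoundedFormula α m)
    (v : α → WithTop Γ) (xs : Fin m → WithTop Γ) :
    Sat ψ P ((langInclusion K).onBoundedFormula φ) v xs ↔ Sat ψ P φ v xs := by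
  let _ := toStructure k ψ P
  let _ : (lang K).Structure (WithTop Γ) := toStructure K ψ P
  have : (langInclusion K).IsExpansionOn (WithTop Γ) :=
    ⟨fun f x => by cases f <;> rfl, fun R x => by cases R <;> rfl⟩
  exact (langInclusion K).realize_onBoundedFormula φ

theorem isQF_onBoundedFormula {L L' : Language} (g : L →ᴸ L') {β : Type*} {φ : L.BoundedFormula β m}
    (h : φ.IsQF) : (g.onBoundedFormula φ).IsQF := by
  induction h with
  | falsum => exact BoundedFormula.isQF_bot
  | of_isAtomic h =>
    cases h with
    | equal t₁ t₂ => exact (BoundedFormula.IsAtomic.equal _ _).isQF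
    | rel R ts => exact (BoundedFormula.IsAtomic.rel _ _).isQF
  | imp _ _ ih₁ ih₂ => exact ih₁.imp ih₂

theorem exists_onFunction_eq {l : ℕ} (f : (lang k).Functions l) :
    ∃ s : Set k, s.Countable ∧ ∀ K : Subfield k, s ⊆ K → ∃ f', (langInclusion K).onFunction f' = f := by
  cases f with
  | zero => exact ⟨∅, Set.countable_empty, fun K _ => ⟨Func.zero, rfl⟩⟩
  | infty => exact ⟨∅, Set.countable_empty, fun K _ => ⟨Func.infty, rfl⟩⟩
  | neg => exact ⟨∅, Set.countable_empty, fun K _ => ⟨Func.neg, rfl⟩⟩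
  | psi => exact ⟨∅, Set.countable_empty, fun K _ => ⟨Func.psi, rfl⟩⟩
  | smul c => exact ⟨{c}, Set.countable_singleton c, fun K hK => ⟨Func.smul ⟨c, hK rfl⟩, rfl⟩⟩
  | add => exact ⟨∅, Set.countable_empty, fun K _ => ⟨Func.add, rfl⟩⟩

theorem exists_onTerm_eq {β : Type*} (t : (lang k).Term β) :
    ∃ s : Set k, s.Countable ∧ ∀ K : Subfield k, s ⊆ K → ∃ t', (langInclusion K).onTerm t' = t := by
  induction t with
  | var i => exact ⟨∅, Set.countable_empty, fun K _ => ⟨Term.var i, rfl⟩⟩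
  | func f ts ih =>
    obtain ⟨s₀, hs₀, h₀⟩ := exists_onFunction_eq f
    choose s hs h using ih
    refine ⟨s₀ ∪ ⋃ i, s i, hs₀.union (Set.countable_iUnion hs), fun K hK => ?_⟩
    obtain ⟨f', rfl⟩ := h₀ K (Set.subset_union_left.trans hK)
    choose t' ht' using fun i => h i K
      ((Set.subset_iUnion s i).trans (Set.subset_union_right.trans hK))
    exact ⟨Term.func f' t', congrArg (Term.func _) (funext ht')⟩

/-- Every formula over `k` is a formula over some countable subfield. -/
theorem exists_onBoundedFormula_eq (φ : (lang k).BoundedFormula α m) :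
    ∃ s : Set k, s.Countable ∧ ∀ K : Subfield k, s ⊆ K →
      ∃ φ', (langInclusion K).onBoundedFormula φ' = φ := by
  induction φ with
  | falsum => exact ⟨∅, Set.countable_empty, fun K _ => ⟨BoundedFormula.falsum, rfl⟩⟩
  | equal t₁ t₂ =>
    obtain ⟨s₁, hs₁, h₁⟩ := exists_onTerm_eq t₁
    obtain ⟨s₂, hs₂, h₂⟩ := exists_onTerm_eq t₂
    refine ⟨s₁ ∪ s₂, hs₁.union hs₂, fun K hK => ?_⟩
    obtain ⟨t₁', rfl⟩ := h₁ K (Set.subset_union_left.trans hK)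
    obtain ⟨t₂', rfl⟩ := h₂ K (Set.subset_union_right.trans hK)
    exact ⟨BoundedFormula.equal t₁' t₂', rfl⟩
  | rel R ts =>
    choose s hs h using fun i => exists_onTerm_eq (ts i)
    refine ⟨⋃ i, s i, Set.countable_iUnion hs, fun K hK => ?_⟩
    choose t' ht' using fun i => h i K ((Set.subset_iUnion s i).trans hK)
    obtain rfl : (fun i => (langInclusion K).onTerm (t' i)) = ts := funext ht'
    exact ⟨BoundedFormula.rel R t', rfl⟩
  | imp φ₁ φ₂ ih₁ ih₂ =>
    obtain ⟨s₁, hs₁, h₁⟩ := ih₁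
    obtain ⟨s₂, hs₂, h₂⟩ := ih₂
    refine ⟨s₁ ∪ s₂, hs₁.union hs₂, fun K hK => ?_⟩
    obtain ⟨φ₁', rfl⟩ := h₁ K (Set.subset_union_left.trans hK)
    obtain ⟨φ₂', rfl⟩ := h₂ K (Set.subset_union_right.trans hK)
    exact ⟨φ₁'.imp φ₂', rfl⟩
  | all φ ih =>
    obtain ⟨s, hs, h⟩ := ih
    refine ⟨s, hs, fun K hK => ?_⟩
    obtain ⟨φ', rfl⟩ := h K hK
    exact ⟨φ'.all, rfl⟩

/-- A closed H-triple over `k` is a closed H-triple over each subfield. -/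
def ClosedTriple.restrict (K : Subfield k) (T : ClosedTriple.{u, w} k) : ClosedTriple.{u, w} K where
  carrier := T.carrier
  posSMul := ⟨fun _ hc _ _ hxy => smul_lt_smul_of_pos_left (α := k) hxy hc⟩
  psi := T.psi
  cut := T.cut
  closed := ⟨⟨⟨T.closed.couple.toIsHCouple, fun c γ hc hγ =>
    T.closed.couple.psi_smul (c : k) γ (fun h => hc (Subtype.ext h)) hγ⟩, T.closed.cut⟩,
    T.closed.closed⟩

/-- The scalars in `φ` generate a countable subfield, and every closed H-triple over `k` is one over
that subfield; the formula eliminated there is read back over `k`. -/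
theorem exists_isQF_iff [Finite α] (φ : (lang k).BoundedFormula α m) :
    ∃ θ : (lang k).BoundedFormula α m, θ.IsQF ∧ ∀ T : ClosedTriple.{u, w} k, ∀ v xs,
      Sat T.psi T.cut θ v xs ↔ Sat T.psi T.cut φ v xs := by
  obtain ⟨s, hs, h⟩ := exists_onBoundedFormula_eq φ
  have hcount : Countable (Subfield.closure s) := by
    rw [← Cardinal.mk_le_aleph0_iff]
    exact (Subfield.cardinalMk_closure_le_max s).trans (max_le hs.le_aleph0 le_rfl)
  obtain ⟨φ', rfl⟩ := h (Subfield.closure s) Subfield.subset_closure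
  obtain ⟨θ, hθ, hθφ⟩ := exists_isQF_iff_of_countable.{u, w} φ'
  refine ⟨(langInclusion _).onBoundedFormula θ, isQF_onBoundedFormula _ hθ, fun T v xs => ?_⟩
  rw [sat_langInclusion, sat_langInclusion]
  exact hθφ (T.restrict _) v xs

end Descent

/-- The universal closure of a formula. -/
noncomputable def univClosure {L : Language} {n : ℕ} (σ : L.Formula (Fin n)) : L.Sentence :=
  Formula.iAlls (Fin n) (σ.relabel (Sum.inr : Fin n → Empty ⊕ Fin n))

theorem realize_univClosure {L : Language} {n : ℕ} (σ : L.Formula (Fin n)) {X : Type*}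
    [L.Structure X] : X ⊨ univClosure σ ↔ ∀ v : Fin n → X, σ.Realize v := by
  rw [univClosure, Sentence.Realize, Formula.realize_iAlls]
  exact forall_congr' fun v => Formula.realize_relabel

end HTriple

open FirstOrder Language in
theorem mainTheorem2 (k : Type u) [Field k] [LinearOrder k] [IsStrictOrderedRing k] :
    (HTriple.closedTheory.{u, w} k).HasQE := by
  intro n φ
  obtain ⟨θ, hθ, h⟩ := HTriple.exists_isQF_iff.{u, max u w} φ
  refine ⟨θ, hθ, ?_⟩
  -- A model of the theory need not be presented as a closed H-triple; the equivalence reaches it as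
  -- a sentence belonging to the theory.
  have hmem : HTriple.univClosure (φ.iff θ) ∈ HTriple.closedTheory.{u, w} k := by
    intro Γ _ _ _ _ _ ψ P hP
    refine (@HTriple.realize_univClosure _ _ _ _ (HTriple.toStructure k ψ P)).2 fun v => ?_
    refine (@BoundedFormula.realize_iff _ _ (HTriple.toStructure k ψ P) _ _ _ _ _ _).2 ?_
    exact (h ⟨Γ, ψ, P, hP⟩ v _).symm
  intro M v xs
  have hM := (HTriple.realize_univClosure (φ.iff θ)).1
    (Theory.realize_sentence_of_mem (M := M) _ hmem) v
  rwa [Subsingleton.elim xs default]
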